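/- Let $\mathbb D$ be the open unit disk and $\mathbb T$ the unit circle. For $f$ holomorphic on $\mathbb D$ put $\mathcal I(f)=\frac1\pi\iint_{\mathbb D}|f'(z)|^2\,dx\,dy$, and let $\mathcal D$ be the space of holomorphic $f$ on $\mathbb D$ with $\mathcal I(f)<\infty$. Write $f^*(\zeta)=\lim_{r\to1^-}f(r\zeta)$ for $\zeta\in\mathbb T$ whenever the limit exists. A function $f$ is outer if $$f(z)=\exp\Bigl(\frac1{2\pi}\int_{\mathbb T}\frac{\zeta+z}{\zeta-z}\log\phi(\zeta)\,|d\zeta|\Bigr)\qquad(z\in\mathbb D)$$ for some positive function $\phi$ on $\mathbb T$ with $\log\phi\in L^1(\mathbb T)$; then $f^*$ exists a.e. Let $d$ denote arclength distance on $\mathbb T$. Let $E$ be a non-empty closed subset of $\mathbb T$ of Lebesgue measure zero. Let $h_1,\dots,h_n\in\mathcal D$ be outer functions satisfying $|h_j^*(\zeta)|\le\pi^{-1}d(\zeta,E)$ for a.e. $\zeta\in\mathbb T$ $(j=1,\dots,n)$. Let $\mathbb T\setminus E=U_1\cup\dots\cup U_n$, where $U_1,\dots,U_n$ are pairwise disjoint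 open sets, some of which may be empty. Then there is an outer function $h$ such that $|h^*|=|h_j^*|$ a.e. on $U_j$ for $j=1,\dots,n$, and every such $h$ satisfies $h\in\mathcal D$ and $$\mathcal I(h)\le\sum_{j=1}^n\mathcal I(h_j)+\frac12\sum_{j=1}^n\log\frac1{|h_j(0)|}.$$ -/

import Mathlib

open MeasureTheory Filter Topology Set

/-- The Borel σ-algebra on the unit circle. -/
noncomputable instance instMeasurableSpaceCircle : MeasurableSpace Circle := borel Circle

instance instBorelSpaceCircle : BorelSpace Circle := ⟨rfl⟩

/-- Arclength measure `|dζ|` on the unit circle (total mass `2π`). -/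
noncomputable def arcLength : Measure Circle :=
  Measure.map Circle.exp ((volume : Measure ℝ).restrict (Ioc (-Real.pi) Real.pi))

/-- Arclength distance on the unit circle: the length of the shorter arc between two points. -/
noncomputable def arcDist (ζ ξ : Circle) : ℝ :=
  |Complex.arg ((ζ : ℂ) / (ξ : ℂ))|

/-- Arclength distance `d(ζ, E)` from a point to a (non-empty) subset of the unit circle. -/
noncomputable def arcInfDist (ζ : Circle) (E : Set Circle) : ℝ :=
  sInf (arcDist ζ '' E)

/-- The Dirichlet integral `(1/π) ∬_𝔻 |f'(z)|² dx dy`, with values in `[0, ∞]`. -/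
noncomputable def dirichletIntegral (f : ℂ → ℂ) : ENNReal :=
  ENNReal.ofReal (1 / Real.pi) * ∫⁻ z in Metric.ball (0 : ℂ) 1, ‖deriv f z‖ₑ ^ 2

/-- Membership in the Dirichlet space: holomorphic on the open unit disk with finite Dirichlet
integral. Values of `f` off the disk are irrelevant. -/
def InDirichletSpace (f : ℂ → ℂ) : Prop :=
  DifferentiableOn ℂ f (Metric.ball 0 1) ∧ dirichletIntegral f < ⊤

/-- `f` is outer: on the open unit disk it is the exponential of the Herglotz integral of
`log φ`, for some positive function `φ` on the circle with `log φ` integrable. -/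
def IsOuter (f : ℂ → ℂ) : Prop :=
  ∃ φ : Circle → ℝ, (∀ ζ, 0 < φ ζ) ∧ Integrable (fun ζ => Real.log (φ ζ)) arcLength ∧
    ∀ z ∈ Metric.ball (0 : ℂ) 1,
      f z = Complex.exp (1 / (2 * (Real.pi : ℂ)) *
        ∫ ζ, ((ζ : ℂ) + z) / ((ζ : ℂ) - z) * (Real.log (φ ζ) : ℂ) ∂arcLength)

/-- The radial boundary value `f*(ζ) = lim_{r → 1⁻} f(rζ)`. Where the limit does not exist the
value is arbitrary; for an outer function this happens only on a set of measure zero. -/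
noncomputable def radialLimit (f : ℂ → ℂ) (ζ : Circle) : ℂ :=
  limUnder (𝓝[<] (1 : ℝ)) (fun r : ℝ => f ((r : ℂ) * (ζ : ℂ)))

open scoped Real ENNReal

/-! For an outer function f with boundary modulus exp u ≤ 1, Carleson's formula reads I(f) = (4π²)⁻¹
∬ (e^{2u(ζ)} − e^{2u(ξ)})(u(ζ) − u(ξ)) / |ζ−ξ|² |dζ||dξ|. The integrand is nonnegative and depends
only on the boundary modulus, so glued functions can be compared pointwise. If ζ and ξ lie in the
same U_j, the integrand is that of h_j. If they lie in different pieces U_j and U_k, the shorter arc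
between them meets E (`exists_mem_arcDist_le`), so both moduli are at most π⁻¹(π/2)|ζ−ξ| = |ζ−ξ|/2
and the integrand is at most ¼(log 1/|h_j*(ζ)| + log 1/|h_k*(ξ)|). Integrating over the torus
(`carlesonEnergy_le_sum`) gives π∫log 1/|h_j*| = 2π² log 1/|h_j(0)|, and the factor (4π²)⁻¹ turns
this into the ½ log term.

Carleson's formula is split into `dirichletIntegral_outerExp_le` and
`carlesonEnergy_le_dirichletIntegral_outerExp`. With P_s the Poisson operator, the double integral
weighted by the Poisson kernel in place of |ζ−ξ|⁻² equals 4π∫e^{2u}(u − P_s u). Convexity of exp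
compares this with the drop of ∫|f|² between two circles, which Parseval writes as Σ
2π|a_n|²(1−s^{2n}). Dividing by 1−s² and letting s → 1 yields Σ n|a_n|² = I(f) on one side and the
kernel |ζ−ξ|⁻² on the other. The upper bound works directly on the boundary. The lower bound works
on circles of radius r < 1, where convexity loses only O((1−s)²), and then uses Fatou's lemma for s
→ 1 and r → 1. Fatou's theorem on radial limits identifies |f*| with exp u. -/

/-! ### Arclength measure and the additive circle. -/

instance fact_two_pi_pos : Fact (0 < 2 * π) := ⟨Real.two_pi_pos⟩

lemma toCircle_coe_eq_exp (x : ℝ) : AddCircle.toCircle (x : AddCircle (2 * π)) = Circle.exp x := by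
  rw [AddCircle.toCircle_apply_mk, div_self (by positivity), one_mul]

lemma measurableEmbedding_toCircle :
    MeasurableEmbedding (AddCircle.toCircle : AddCircle (2 * π) → Circle) := by
  convert (AddCircle.homeomorphCircle (T := 2 * π) (by positivity)).measurableEmbedding using 1
  ext x
  rw [AddCircle.homeomorphCircle_apply]

lemma measurePreserving_toCircle :
    MeasurePreserving (AddCircle.toCircle : AddCircle (2 * π) → Circle) volume arcLength := by
  have h1 := AddCircle.measurePreserving_mk (2 * π) (-π)
  refine ⟨measurableEmbedding_toCircle.measurable, ?_⟩
  rw [← h1.map_eq, Measure.map_map measurableEmbedding_toCircle.measurable h1.measurable, arcLength]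
  have : -π + 2 * π = π := by ring
  rw [this]
  congr 1
  ext1 x
  exact toCircle_coe_eq_exp x

instance isFiniteMeasure_arcLength : IsFiniteMeasure arcLength :=
  ⟨by
    rw [← measurePreserving_toCircle.measure_preimage MeasurableSet.univ.nullMeasurableSet]
    exact measure_lt_top _ _⟩

lemma arcLength_univ : arcLength univ = ENNReal.ofReal (2 * π) := by
  rw [← measurePreserving_toCircle.measure_preimage MeasurableSet.univ.nullMeasurableSet,
    preimage_univ, AddCircle.measure_univ]

section
variable {E : Type*} [NormedAddCommGroup E] [NormedSpace ℝ E]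

lemma integral_arcLength_eq_addCircle (F : Circle → E) :
    ∫ ζ, F ζ ∂arcLength = ∫ x : AddCircle (2 * π), F (AddCircle.toCircle x) :=
  (measurePreserving_toCircle.integral_comp measurableEmbedding_toCircle F).symm

lemma integral_arcLength_eq_circleAverage (F : ℂ → E) :
    ∫ ζ : Circle, F ζ ∂arcLength = (2 * π) • Real.circleAverage F 0 1 := by
  rw [integral_arcLength_eq_addCircle, Real.circleAverage_def, smul_smul,
    mul_inv_cancel₀ (by positivity), one_smul]
  have h := AddCircle.intervalIntegral_preimage (2 * π) 0
    (fun x => F (AddCircle.toCircle x))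
  rw [← h, zero_add]
  simp only [toCircle_coe_eq_exp, Circle.coe_exp, circleMap, zero_add, Complex.ofReal_one, one_mul]
end

lemma circleIntegrable_of_integrable_arcLength {E : Type*} [NormedAddCommGroup E]
    {F : ℂ → E}
    (hF : Integrable (fun ζ : Circle => F ζ) arcLength) : CircleIntegrable F 0 1 := by
  rw [CircleIntegrable, intervalIntegrable_iff_integrableOn_Ioc_of_le (by positivity)]
  have h1 := measurePreserving_toCircle.comp (AddCircle.measurePreserving_mk (2 * π) 0)
  have h2 := h1.integrable_comp_of_integrable hF
  rw [zero_add] at h2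
  refine h2.congr (ae_of_all _ fun x => ?_)
  simp only [Function.comp_apply, circleMap, zero_add, Complex.ofReal_one, one_mul]
  exact congrArg F (by rw [toCircle_coe_eq_exp, Circle.coe_exp])


/-! ### The Poisson kernel and Poisson integrals. -/

/-- The Poisson kernel of the unit disk. -/
noncomputable def diskPoisson (z : ℂ) (ζ : Circle) : ℝ := (1 - ‖z‖ ^ 2) / ‖(ζ : ℂ) - z‖ ^ 2

lemma circle_sub_ne_zero {z : ℂ} (hz : ‖z‖ < 1) (ζ : Circle) : (ζ : ℂ) - z ≠ 0 := by
  intro h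
  rw [sub_eq_zero] at h
  rw [← h, Circle.norm_coe] at hz
  exact lt_irrefl _ hz

lemma diskPoisson_nonneg {z : ℂ} (hz : ‖z‖ < 1) (ζ : Circle) : 0 ≤ diskPoisson z ζ := by
  unfold diskPoisson
  have : ‖z‖ ^ 2 ≤ 1 := pow_le_one₀ (norm_nonneg _) hz.le
  exact div_nonneg (by linarith) (by positivity)

lemma continuous_diskPoisson {z : ℂ} (hz : ‖z‖ < 1) : Continuous (diskPoisson z) := by
  unfold diskPoisson
  refine Continuous.div (by fun_prop) (by fun_prop) fun ζ => ?_
  have := circle_sub_ne_zero hz ζ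
  positivity

lemma diskPoisson_eq_poissonKernel (z : ℂ) (ζ : Circle) :
    diskPoisson z ζ = poissonKernel 0 z ζ := by
  simp [diskPoisson, poissonKernel_def, Circle.norm_coe]

lemma diskPoisson_eq_re (z : ℂ) (ζ : Circle) :
    diskPoisson z ζ = (((ζ : ℂ) + z) / ((ζ : ℂ) - z)).re := by
  rw [diskPoisson_eq_poissonKernel, poissonKernel_eq_re_herglotzRieszKernel]
  simp [herglotzRieszKernel_def]

lemma one_sub_le_norm_circle_sub (z : ℂ) (ζ : Circle) : 1 - ‖z‖ ≤ ‖(ζ : ℂ) - z‖ := by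
  have := norm_sub_norm_le (ζ : ℂ) z
  rwa [Circle.norm_coe] at this

lemma diskPoisson_le {z : ℂ} (hz : ‖z‖ < 1) (ζ : Circle) :
    diskPoisson z ζ ≤ 2 / (1 - ‖z‖) := by
  unfold diskPoisson
  have h := one_sub_le_norm_circle_sub z ζ
  have h0 : 0 < 1 - ‖z‖ := by linarith
  calc (1 - ‖z‖ ^ 2) / ‖(ζ : ℂ) - z‖ ^ 2 ≤ (2 * (1 - ‖z‖)) / (1 - ‖z‖) ^ 2 := by
        gcongr
        nlinarith [norm_nonneg z]
    _ = 2 / (1 - ‖z‖) := by field_simp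

/-- The right side is symmetric in ζ and ξ, hence so is the Poisson kernel; its radial and chordal
terms give the kernel estimates. -/
lemma norm_sub_real_mul_sq (s : ℝ) (ζ ξ : Circle) :
    ‖(ξ : ℂ) - s * ζ‖ ^ 2 = (1 - s) ^ 2 + s * ‖(ζ : ℂ) - ξ‖ ^ 2 := by
  have h1 : Complex.normSq ζ = 1 := by simp
  have h2 : Complex.normSq ξ = 1 := by simp
  simp only [← Complex.normSq_eq_norm_sq, Complex.normSq_apply] at *
  simp
  linear_combination (s ^ 2 - s) * h1 + (1 - s) * h2

section
variable {E : Type*} [NormedAddCommGroup E] [NormedSpace ℝ E]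

lemma integrable_diskPoisson_smul {z : ℂ} (hz : ‖z‖ < 1) {G : Circle → E}
    (hG : Integrable G arcLength) :
    Integrable (fun ζ => diskPoisson z ζ • G ζ) arcLength := by
  refine hG.bdd_smul (2 / (1 - ‖z‖)) (continuous_diskPoisson hz).aestronglyMeasurable ?_
  refine ae_of_all _ fun ζ => ?_
  rw [Real.norm_of_nonneg (diskPoisson_nonneg hz ζ)]
  exact diskPoisson_le hz ζ

/-- The Poisson integral of a function on the circle. -/
noncomputable def poissonIntegral (G : Circle → E) (z : ℂ) : E :=
  (2 * π)⁻¹ • ∫ ζ, diskPoisson z ζ • G ζ ∂arcLength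
end

lemma poissonIntegral_of_diffContOnCl {g : ℂ → ℂ} (hg : DiffContOnCl ℂ g (Metric.ball 0 1))
    {z : ℂ} (hz : ‖z‖ < 1) : poissonIntegral (fun ζ : Circle => g ζ) z = g z := by
  have h := hg.circleAverage_poissonKernel_smul (w := z) (by simpa using hz)
  have h2 := integral_arcLength_eq_circleAverage (poissonKernel 0 z • g)
  rw [h] at h2
  rw [poissonIntegral]
  simp only [diskPoisson_eq_poissonKernel]
  simp only [Pi.smul_apply'] at h2
  rw [h2, smul_smul, inv_mul_cancel₀ (by positivity), one_smul]

lemma integral_diskPoisson {z : ℂ} (hz : ‖z‖ < 1) : ∫ ζ, diskPoisson z ζ ∂arcLength = 2 * π := by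
  have h := poissonIntegral_of_diffContOnCl (g := fun _ => 1) diffContOnCl_const hz
  have h2 : ((∫ ζ, diskPoisson z ζ ∂arcLength : ℝ) : ℂ) = 2 * π := by
    rw [← integral_complex_ofReal]
    simp only [poissonIntegral, Complex.real_smul, mul_one] at h
    have : (((2 * π)⁻¹ : ℝ) : ℂ) ≠ 0 := by
      exact_mod_cast (by positivity)
    rw [mul_comm, ← eq_div_iff this] at h
    rw [h]; push_cast; simp
  exact_mod_cast h2

/-! ### Herglotz integrals and outer functions. -/

/-- The Herglotz integral of a function on the circle. -/
noncomputable def herglotz (u : Circle → ℝ) (z : ℂ) : ℂ :=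
  1 / (2 * (π : ℂ)) * ∫ ζ, ((ζ : ℂ) + z) / ((ζ : ℂ) - z) * (u ζ : ℂ) ∂arcLength

lemma norm_herglotz_kernel_le {z : ℂ} (hz : ‖z‖ < 1) (ζ : Circle) :
    ‖((ζ : ℂ) + z) / ((ζ : ℂ) - z)‖ ≤ 2 / (1 - ‖z‖) := by
  rw [norm_div]
  have h := one_sub_le_norm_circle_sub z ζ
  have h0 : 0 < 1 - ‖z‖ := by linarith
  have h1 := norm_add_le (ζ : ℂ) z
  rw [Circle.norm_coe] at h1
  gcongr
  linarith

lemma integrable_herglotz {u : Circle → ℝ} (hu : Integrable u arcLength) {z : ℂ} (hz : ‖z‖ < 1) :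
    Integrable (fun ζ : Circle => ((ζ : ℂ) + z) / ((ζ : ℂ) - z) * (u ζ : ℂ)) arcLength := by
  refine hu.ofReal.bdd_mul (c := 2 / (1 - ‖z‖)) ?_ (ae_of_all _ (norm_herglotz_kernel_le hz))
  refine Continuous.aestronglyMeasurable ?_
  exact Continuous.div (by fun_prop) (by fun_prop) (circle_sub_ne_zero hz)

lemma re_herglotz {u : Circle → ℝ} (hu : Integrable u arcLength) {z : ℂ} (hz : ‖z‖ < 1) :
    (herglotz u z).re = poissonIntegral u z := by
  have h : (1 / (2 * (π : ℂ))) = (((2 * π)⁻¹ : ℝ) : ℂ) := by push_cast; simp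
  rw [herglotz, h, Complex.re_ofReal_mul, poissonIntegral, smul_eq_mul]
  congr 1
  have := integral_re (𝕜 := ℂ) (integrable_herglotz hu hz)
  simp only [RCLike.re_eq_complex_re] at this
  rw [← this]
  congr 1 with ζ
  rw [Complex.re_mul_ofReal, diskPoisson_eq_re, smul_eq_mul]

lemma differentiableOn_herglotz {u : Circle → ℝ} (hu : Integrable u arcLength) :
    DifferentiableOn ℂ (herglotz u) (Metric.ball 0 1) := by
  -- Circle averages take functions on the plane, so `u` is extended along rays.
  let F : ℂ → ℂ := fun z => (u (Circle.exp (Complex.arg z)) : ℂ)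
  have hF : ∀ ζ : Circle, F ζ = u ζ := fun ζ => by simp [F]
  have h1 : CircleIntegrable F 0 1 := by
    apply circleIntegrable_of_integrable_arcLength
    simp only [hF]
    exact hu.ofReal
  refine (differentiableOn_circleAverage_herglotzRieszKernel_smul h1).congr fun z hz => ?_
  have h2 := integral_arcLength_eq_circleAverage (fun ζ => herglotzRieszKernel 0 z ζ • F ζ)
  simp only [herglotzRieszKernel_def, hF, sub_zero, smul_eq_mul] at h2 ⊢
  rw [herglotz, h2]
  have : (π : ℂ) ≠ 0 := by simp [Real.pi_ne_zero]
  rw [Complex.real_smul]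
  push_cast
  field_simp

/-- The outer function with boundary modulus `exp u`. -/
noncomputable def outerExp (u : Circle → ℝ) (z : ℂ) : ℂ := Complex.exp (herglotz u z)

lemma differentiableOn_outerExp {u : Circle → ℝ} (hu : Integrable u arcLength) :
    DifferentiableOn ℂ (outerExp u) (Metric.ball 0 1) :=
  (differentiableOn_herglotz hu).cexp

lemma norm_outerExp {u : Circle → ℝ} (hu : Integrable u arcLength) {z : ℂ} (hz : ‖z‖ < 1) :
    ‖outerExp u z‖ = Real.exp (poissonIntegral u z) := by
  rw [outerExp, Complex.norm_exp, re_herglotz hu hz]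

lemma herglotz_sub {u v : Circle → ℝ} (hu : Integrable u arcLength) (hv : Integrable v arcLength)
    {z : ℂ} (hz : ‖z‖ < 1) : herglotz (fun ζ => u ζ - v ζ) z = herglotz u z - herglotz v z := by
  simp only [herglotz]
  rw [← mul_sub, ← integral_sub (integrable_herglotz hu hz) (integrable_herglotz hv hz)]
  congr 2 with ζ
  push_cast
  ring

lemma poissonIntegral_nonpos {u : Circle → ℝ} (hu : ∀ᵐ ζ ∂arcLength, u ζ ≤ 0) {z : ℂ}
    (hz : ‖z‖ < 1) : poissonIntegral u z ≤ 0 := by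
  refine mul_nonpos_of_nonneg_of_nonpos (by positivity) (integral_nonpos_of_ae ?_)
  filter_upwards [hu] with ζ h
  exact mul_nonpos_of_nonneg_of_nonpos (diskPoisson_nonneg hz ζ) h

lemma norm_outerExp_le_one {u : Circle → ℝ} (hu : Integrable u arcLength)
    (h0 : ∀ᵐ ζ ∂arcLength, u ζ ≤ 0) {z : ℂ} (hz : ‖z‖ < 1) : ‖outerExp u z‖ ≤ 1 := by
  rw [norm_outerExp hu hz]
  exact Real.exp_le_one_iff.2 (poissonIntegral_nonpos h0 hz)

/-! ### Fatou's theorem for Poisson integrals, via Lebesgue points. -/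

lemma two_div_pi_mul_dist_le_norm_toCircle_sub (x y : AddCircle (2 * π)) :
    2 / π * dist x y ≤ ‖(AddCircle.toCircle x : ℂ) - AddCircle.toCircle y‖ := by
  obtain ⟨t, ht, hxy⟩ : ∃ t : ℝ, t ∈ Ioc (-π) π ∧ x - y = (t : AddCircle (2 * π)) := by
    obtain ⟨t, ht⟩ := (AddCircle.equivIoc (2 * π) (-π)).symm.surjective (x - y)
    refine ⟨t, ⟨t.2.1, ?_⟩, ht.symm⟩
    have := t.2.2
    linarith
  have hd : dist x y = |t| := by
    rw [dist_eq_norm, hxy, AddCircle.norm_coe_eq_abs_iff _ (by positivity),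
      abs_of_pos (by positivity : 0 < 2 * π), abs_le]
    constructor <;> linarith [ht.1, ht.2]
  have hx : x = y + t := by rw [← hxy]; abel
  have h := Complex.mul_angle_le_norm_sub (x := Circle.exp t) (y := 1) (Circle.norm_coe _) (by simp)
  rw [Complex.angle_eq_abs_arg (by simp) (by simp), div_one, Circle.arg_exp ht.1 ht.2, ← hd] at h
  refine h.trans (le_of_eq ?_)
  rw [hx, AddCircle.toCircle_add, toCircle_coe_eq_exp, Circle.coe_mul, ← mul_sub_one, norm_mul,
    Circle.norm_coe, one_mul]

/-- Only the term with the least k such that d ≤ 2^k η is needed. If k > 0 then d > 2^(k-1) η, so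
the profile is at most η/d² ≤ 4/(4^k η). This dominates the kernel by a superposition of indicators
of balls. -/
lemma poisson_profile_le_tsum {η d : ℝ} (hη : 0 < η) :
    ENNReal.ofReal (η / (η ^ 2 + d ^ 2)) ≤
      ∑' k : ℕ, ENNReal.ofReal (4 / η * (1 / 4) ^ k) * (if d ≤ 2 ^ k * η then 1 else 0) := by
  have hex : ∃ k : ℕ, d ≤ 2 ^ k * η := by
    obtain ⟨k, hk⟩ := pow_unbounded_of_one_lt (d / η) (one_lt_two)
    exact ⟨k, by rw [div_lt_iff₀ hη] at hk; exact hk.le⟩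
  classical
  let k := Nat.find hex
  have hk : d ≤ 2 ^ k * η := Nat.find_spec hex
  refine le_trans ?_ (ENNReal.le_tsum k)
  rw [if_pos hk, mul_one]
  apply ENNReal.ofReal_le_ofReal
  rcases Nat.eq_zero_or_pos k with h0 | h0
  · rw [h0, pow_zero, mul_one, div_le_div_iff₀ (by positivity) hη]
    nlinarith [sq_nonneg d, sq_nonneg η]
  · have h1 : 2 ^ (k - 1) * η < d := not_le.1 (Nat.find_min hex (Nat.sub_lt h0 one_pos))
    have h2 : (2 : ℝ) ^ k = 2 * 2 ^ (k - 1) := by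
      rw [← pow_succ', Nat.sub_add_cancel h0]
    have h4 : (1 / 4 : ℝ) ^ k = 1 / (2 ^ k) ^ 2 := by
      rw [← pow_mul, mul_comm k 2, pow_mul, one_div_pow]; norm_num
    rw [h4, h2, ← mul_div_assoc, mul_one, div_div, div_le_div_iff₀ (by positivity) (by positivity)]
    have h5 : (2 ^ (k - 1) * η) ^ 2 ≤ d ^ 2 := by gcongr
    nlinarith [sq_nonneg η, sq_nonneg d]

/-- If the averages `m δ` tend to `0` and stay bounded, so does their dyadic superposition. -/
lemma tendsto_tsum_dyadic {m : ℝ → ℝ} {M : ℝ} (hm0 : ∀ δ, 0 < δ → 0 ≤ m δ)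
    (hM : ∀ δ, 0 < δ → m δ ≤ M) (hm : Tendsto m (𝓝[>] 0) (𝓝 0)) :
    Tendsto (fun η => ∑' k : ℕ, (1 / 2 : ℝ) ^ k * m (2 ^ k * η)) (𝓝[>] 0) (𝓝 0) := by
  have h := tendsto_tsum_of_dominated_convergence (𝓕 := 𝓝[>] (0 : ℝ))
    (f := fun η (k : ℕ) => (1 / 2 : ℝ) ^ k * m (2 ^ k * η)) (g := fun _ => 0)
    (bound := fun k => (1 / 2 : ℝ) ^ k * M) (summable_geometric_two.mul_right M) ?_ ?_
  · simpa using h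
  · intro k
    have h1 : Tendsto (fun η : ℝ => 2 ^ k * η) (𝓝[>] 0) (𝓝[>] 0) := by
      refine tendsto_nhdsWithin_iff.2 ⟨?_, ?_⟩
      · have : Tendsto (fun η : ℝ => 2 ^ k * η) (𝓝 0) (𝓝 (2 ^ k * 0)) := by
          apply Continuous.tendsto; fun_prop
        rw [mul_zero] at this
        exact this.mono_left nhdsWithin_le_nhds
      · filter_upwards [self_mem_nhdsWithin] with η hη
        have : (0 : ℝ) < η := hη
        simp only [mem_Ioi]; positivity
    simpa using (hm.comp h1).const_mul ((1 / 2 : ℝ) ^ k)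
  · filter_upwards [self_mem_nhdsWithin] with η hη k
    have h2 : (0 : ℝ) < 2 ^ k * η := mul_pos (by positivity) hη
    rw [Real.norm_of_nonneg (mul_nonneg (by positivity) (hm0 _ h2))]
    gcongr
    exact hM _ h2

/-- The chord is at least (2/π) times the arc, and r ≥ 1/2, so the denominator is at least
(2/π²)((1−r)² + dist²); the numerator is at most 2(1−r). -/
lemma diskPoisson_toCircle_le {r : ℝ} (hr : 1 / 2 ≤ r) (hr1 : r < 1) (x y : AddCircle (2 * π)) :
    diskPoisson (r * AddCircle.toCircle x) (AddCircle.toCircle y) ≤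
      π ^ 2 * ((1 - r) / ((1 - r) ^ 2 + dist x y ^ 2)) := by
  have h0 : 0 < 1 - r := by linarith
  rw [diskPoisson, norm_sub_real_mul_sq, norm_mul, Circle.norm_coe, mul_one, Complex.norm_real,
    Real.norm_of_nonneg (by linarith)]
  have h1 := two_div_pi_mul_dist_le_norm_toCircle_sub x y
  have h2 : (2 / π * dist x y) ^ 2 ≤
      ‖(AddCircle.toCircle x : ℂ) - AddCircle.toCircle y‖ ^ 2 := by gcongr
  have h3 : 2 ≤ π := Real.two_le_pi
  have h4 : 2 / π ^ 2 * ((1 - r) ^ 2 + dist x y ^ 2) ≤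
      (1 - r) ^ 2 + r * ‖(AddCircle.toCircle x : ℂ) - AddCircle.toCircle y‖ ^ 2 := by
    have h5 : 2 / π ^ 2 ≤ 1 := by rw [div_le_one (by positivity)]; nlinarith
    have h6 : 2 / π ^ 2 * dist x y ^ 2 ≤
        r * ‖(AddCircle.toCircle x : ℂ) - AddCircle.toCircle y‖ ^ 2 := by
      calc 2 / π ^ 2 * dist x y ^ 2 = 1 / 2 * (2 / π * dist x y) ^ 2 := by field_simp
        _ ≤ _ := by gcongr
    nlinarith [mul_le_mul_of_nonneg_right h5 (sq_nonneg (1 - r))]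
  calc (1 - r ^ 2) / ((1 - r) ^ 2 + r * ‖(AddCircle.toCircle x : ℂ) - AddCircle.toCircle y‖ ^ 2)
      ≤ (2 * (1 - r)) / (2 / π ^ 2 * ((1 - r) ^ 2 + dist x y ^ 2)) := by
        gcongr
        nlinarith
    _ = _ := by
        have : (1 - r) ^ 2 + dist x y ^ 2 ≠ 0 := by positivity
        field_simp

section
variable {E : Type*} [NormedAddCommGroup E]

lemma ae_tendsto_integral_closedBall_div {G : AddCircle (2 * π) → E} (hG : Integrable G) :
    ∀ᵐ x, Tendsto (fun δ => (∫ y in Metric.closedBall x δ, ‖G y - G x‖) / δ) (𝓝[>] 0) (𝓝 0) := by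
  filter_upwards [IsUnifLocDoublingMeasure.ae_tendsto_average_norm_sub volume
    hG.locallyIntegrable 1] with x hx
  have h := hx (l := 𝓝[>] (0 : ℝ)) (fun _ => x) id tendsto_id (by
    filter_upwards [self_mem_nhdsWithin] with δ hδ
    have : (0 : ℝ) < δ := hδ
    simpa using this.le)
  have h2 := h.const_mul 2
  rw [mul_zero] at h2
  refine h2.congr' ?_
  filter_upwards [Ioo_mem_nhdsGT Real.pi_pos] with δ hδ
  rw [setAverage_eq, Measure.real, id, AddCircle.volume_closedBall, 
    min_eq_right (by linarith [hδ.2]), ENNReal.toReal_ofReal (by linarith [hδ.1]), smul_eq_mul]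
  have := hδ.1.ne'
  field_simp

/-- Small radii are controlled by the limit, radii beyond δ₀ by the total integral over δ₀. -/
lemma exists_integral_closedBall_div_le {x : AddCircle (2 * π)} {w : AddCircle (2 * π) → ℝ}
    (hw : Integrable w) (hw0 : ∀ y, 0 ≤ w y)
    (h : Tendsto (fun δ => (∫ y in Metric.closedBall x δ, w y) / δ) (𝓝[>] 0) (𝓝 0)) :
    ∃ M, ∀ δ, 0 < δ → (∫ y in Metric.closedBall x δ, w y) / δ ≤ M := by
  obtain ⟨δ₀, h0, h1⟩ := (mem_nhdsGT_iff_exists_Ioo_subset (α := ℝ)).1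
    (h.eventually (ge_mem_nhds zero_lt_one))
  have h0 : 0 < δ₀ := h0
  refine ⟨max 1 ((∫ y, w y) / δ₀), fun δ hδ => ?_⟩
  rcases lt_or_ge δ δ₀ with h2 | h2
  · exact (h1 ⟨hδ, h2⟩ : _ ≤ (1 : ℝ)).trans (le_max_left _ _)
  · refine le_trans ?_ (le_max_right _ _)
    have := setIntegral_le_integral (s := Metric.closedBall x δ) hw (ae_of_all _ hw0)
    have h3 : 0 ≤ ∫ y, w y := integral_nonneg hw0
    gcongr

/-- The weight 4^(-k)/(1−r) of the k-th ball, divided through by its radius 2^k(1−r), leaves a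
factor 2^(-k), which makes the series of ball averages summable. -/
lemma lintegral_diskPoisson_mul_le {r : ℝ} (hr : 1 / 2 ≤ r) (hr1 : r < 1) (x : AddCircle (2 * π))
    {w : AddCircle (2 * π) → ℝ} (hw : Integrable w) (hw0 : ∀ y, 0 ≤ w y) :
    ∫⁻ y, ENNReal.ofReal (diskPoisson (r * AddCircle.toCircle x) (AddCircle.toCircle y) * w y) ≤
      ∑' k : ℕ, ENNReal.ofReal (4 * π ^ 2 * ((1 / 2) ^ k *
        ((∫ y in Metric.closedBall x (2 ^ k * (1 - r)), w y) / (2 ^ k * (1 - r))))) := by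
  have h0 : 0 < 1 - r := by linarith
  calc _ ≤ ∫⁻ y, ∑' k : ℕ, ENNReal.ofReal (π ^ 2 * (4 / (1 - r) * (1 / 4) ^ k)) *
        (Metric.closedBall x (2 ^ k * (1 - r))).indicator (fun y => ENNReal.ofReal (w y)) y := by
        refine lintegral_mono fun y => ?_
        rw [ENNReal.ofReal_mul' (hw0 y)]
        calc _ ≤ ENNReal.ofReal (π ^ 2 * ((1 - r) / ((1 - r) ^ 2 + dist x y ^ 2))) *
              ENNReal.ofReal (w y) := by
              gcongr
              exact diskPoisson_toCircle_le hr hr1 x y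
          _ ≤ (ENNReal.ofReal (π ^ 2) * ∑' k : ℕ, ENNReal.ofReal (4 / (1 - r) * (1 / 4) ^ k) *
              (if dist x y ≤ 2 ^ k * (1 - r) then 1 else 0)) * ENNReal.ofReal (w y) := by
              rw [ENNReal.ofReal_mul (by positivity)]
              gcongr
              exact poisson_profile_le_tsum h0
          _ = _ := by
              rw [← ENNReal.tsum_mul_left, ← ENNReal.tsum_mul_right]
              congr 1 with k
              rw [ENNReal.ofReal_mul (by positivity : 0 ≤ π ^ 2)]
              by_cases hy : dist x y ≤ 2 ^ k * (1 - r)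
              · rw [if_pos hy, indicator_of_mem (by rwa [Metric.mem_closedBall, dist_comm])]
                ring
              · rw [if_neg hy, indicator_of_notMem (by rwa [Metric.mem_closedBall, dist_comm])]
                ring
    _ = ∑' k : ℕ, ENNReal.ofReal (π ^ 2 * (4 / (1 - r) * (1 / 4) ^ k)) *
          ENNReal.ofReal (∫ y in Metric.closedBall x (2 ^ k * (1 - r)), w y) := by
        rw [lintegral_tsum]
        · congr 1 with k
          rw [lintegral_const_mul' _ _ ENNReal.ofReal_ne_top,
            lintegral_indicator Metric.isClosed_closedBall.measurableSet,
            ofReal_integral_eq_lintegral_ofReal hw.integrableOn (ae_of_all _ hw0)]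
        · intro k
          exact (hw.aemeasurable.ennreal_ofReal.indicator
            Metric.isClosed_closedBall.measurableSet).const_mul _
    _ = _ := by
        congr 1 with k
        rw [← ENNReal.ofReal_mul (by positivity)]
        congr 1
        have : (1 / 4 : ℝ) ^ k = (1 / 2) ^ k * (1 / 2 ^ k) := by
          rw [one_div_pow, one_div_pow, show (4 : ℝ) = 2 * 2 by norm_num, mul_pow]; field_simp
        rw [this]
        field_simp

variable [NormedSpace ℝ E] [CompleteSpace E]

lemma norm_poissonIntegral_sub_le {G : Circle → E} (hG : Integrable G arcLength) {z : ℂ}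
    (hz : ‖z‖ < 1) (e : E) :
    ‖poissonIntegral G z - e‖ ≤
      (2 * π)⁻¹ * ∫ ζ, diskPoisson z ζ * ‖G ζ - e‖ ∂arcLength := by
  have h1 : poissonIntegral G z - e =
      (2 * π)⁻¹ • ∫ ζ, diskPoisson z ζ • (G ζ - e) ∂arcLength := by
    simp only [smul_sub]
    rw [integral_sub (integrable_diskPoisson_smul hz hG)
      (integrable_diskPoisson_smul hz (integrable_const e)), integral_smul_const,
      integral_diskPoisson hz, smul_sub, smul_smul, inv_mul_cancel₀ (by positivity), one_smul,
      poissonIntegral]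
  rw [h1, norm_smul, Real.norm_of_nonneg (by positivity)]
  gcongr
  refine (norm_integral_le_integral_norm _).trans (le_of_eq ?_)
  congr 1 with ζ
  rw [norm_smul, Real.norm_of_nonneg (diskPoisson_nonneg hz ζ)]

/-- **Fatou's theorem**: the Poisson integral of an integrable function has it as its radial limit
almost everywhere. -/
theorem ae_tendsto_poissonIntegral {G : Circle → E} (hG : Integrable G arcLength) :
    ∀ᵐ ζ : Circle ∂arcLength, Tendsto (fun r : ℝ => poissonIntegral G ((r : ℂ) * (ζ : ℂ))) (𝓝[<] 1)
      (𝓝 (G ζ)) := by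
  rw [← measurePreserving_toCircle.map_eq, measurableEmbedding_toCircle.ae_map_iff]
  have hG' := measurePreserving_toCircle.integrable_comp_of_integrable hG
  filter_upwards [ae_tendsto_integral_closedBall_div hG'] with x hx
  simp only [Function.comp_apply] at hx
  have hw : Integrable (fun y : AddCircle (2 * π) =>
      ‖G (AddCircle.toCircle y) - G (AddCircle.toCircle x)‖) :=
    (hG'.sub (integrable_const _)).norm
  obtain ⟨M, hM⟩ := exists_integral_closedBall_div_le hw (fun y => norm_nonneg _) hx
  set m : ℝ → ℝ := fun δ => (∫ y in Metric.closedBall x δ,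
    ‖G (AddCircle.toCircle y) - G (AddCircle.toCircle x)‖) / δ with hm
  have hm0 : ∀ δ, 0 < δ → 0 ≤ m δ := fun δ hδ =>
    div_nonneg (integral_nonneg fun y => norm_nonneg _) hδ.le
  have hlim := tendsto_tsum_dyadic hm0 hM hx
  have hη : Tendsto (fun r : ℝ => 1 - r) (𝓝[<] 1) (𝓝[>] 0) := by
    refine tendsto_nhdsWithin_iff.2 ⟨?_, ?_⟩
    · have : Tendsto (fun r : ℝ => 1 - r) (𝓝 1) (𝓝 (1 - 1)) := by
        apply Continuous.tendsto; fun_prop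
      rw [sub_self] at this
      exact this.mono_left nhdsWithin_le_nhds
    · filter_upwards [self_mem_nhdsWithin] with r hr
      simpa using hr
  have hlim2 := (hlim.comp hη).const_mul ((2 * π)⁻¹ * (4 * π ^ 2))
  rw [mul_zero] at hlim2
  rw [tendsto_iff_norm_sub_tendsto_zero]
  refine squeeze_zero' (Eventually.of_forall fun r => norm_nonneg _) ?_ hlim2
  filter_upwards [Ico_mem_nhdsLT (show (1 / 2 : ℝ) < 1 by norm_num)] with r hr
  have h0 : 0 < 1 - r := by linarith [hr.2]
  have hz : ‖(r : ℂ) * (AddCircle.toCircle x : ℂ)‖ < 1 := by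
    rw [norm_mul, Circle.norm_coe, mul_one, Complex.norm_real,
      Real.norm_of_nonneg (by linarith [hr.1])]
    exact hr.2
  refine (norm_poissonIntegral_sub_le hG hz _).trans ?_
  rw [mul_assoc]
  refine mul_le_mul_of_nonneg_left ?_ (by positivity)
  have hsum : Summable fun k : ℕ => (1 / 2 : ℝ) ^ k * m (2 ^ k * (1 - r)) := by
    refine Summable.of_nonneg_of_le (fun k => ?_) (fun k => ?_) (summable_geometric_two.mul_right M)
    · exact mul_nonneg (by positivity) (hm0 _ (by positivity))
    · exact mul_le_mul_of_nonneg_left (hM _ (by positivity)) (by positivity)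
  rw [integral_arcLength_eq_addCircle, Function.comp_apply, ← tsum_mul_left]
  have hnn : ∀ k : ℕ, 0 ≤ 4 * π ^ 2 * ((1 / 2 : ℝ) ^ k * m (2 ^ k * (1 - r))) := fun k =>
    mul_nonneg (by positivity) (mul_nonneg (by positivity) (hm0 _ (by positivity)))
  -- In `ℝ≥0∞` sum and integral may be exchanged by nonnegativity alone.
  rw [← ENNReal.ofReal_le_ofReal_iff (tsum_nonneg hnn), ENNReal.ofReal_tsum_of_nonneg hnn
    (hsum.mul_left _), ofReal_integral_eq_lintegral_ofReal]
  · exact lintegral_diskPoisson_mul_le hr.1 hr.2 x hw fun y => norm_nonneg _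
  · exact hw.bdd_mul (c := 2 / (1 - ‖(r : ℂ) * (AddCircle.toCircle x : ℂ)‖))
      ((continuous_diskPoisson hz).measurable.comp
        measurableEmbedding_toCircle.measurable).aestronglyMeasurable
      (ae_of_all _ fun y => by
        rw [Real.norm_of_nonneg (diskPoisson_nonneg hz _)]; exact diskPoisson_le hz _)
  · exact ae_of_all _ fun y => mul_nonneg (diskPoisson_nonneg hz _) (norm_nonneg _)
end

/-! ### Parseval's identity and radial limits of bounded holomorphic functions. -/

lemma HasSum.of_eq {f g : ℕ → ℂ} {a : ℂ} (hf : HasSum f a) (h : ∀ n, f n = g n) : HasSum g a :=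
  funext h ▸ hf

lemma Orthonormal.hasSum_norm_sq {ι H : Type*} [NormedAddCommGroup H] [InnerProductSpace ℂ H]
    {v : ι → H} (hv : Orthonormal ℂ v) {c : ι → ℂ} {x : H} (h : HasSum (fun i => c i • v i) x) :
    HasSum (fun i => ‖c i‖ ^ 2) (‖x‖ ^ 2) := by
  have h1 : Tendsto (fun s : Finset ι => ‖∑ i ∈ s, c i • v i‖ ^ 2) atTop (𝓝 (‖x‖ ^ 2)) :=
    Tendsto.pow (Tendsto.norm h) 2
  refine h1.congr fun s => ?_
  show _ = ∑ i ∈ s, ‖c i‖ ^ 2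
  have h2 := hv.inner_sum c c s
  rw [inner_self_eq_norm_sq_to_K] at h2
  have h3 : ∀ i, (starRingEnd ℂ) (c i) * c i = ((‖c i‖ ^ 2 : ℝ) : ℂ) := fun i => by
    rw [Complex.conj_mul']; push_cast; rfl
  simp only [h3] at h2
  exact Complex.ofReal_injective (by push_cast; simpa using h2)

lemma norm_toLp_sq_eq_integral_arcLength (F : C(AddCircle (2 * π), ℂ)) (f : Circle → ℂ)
    (hf : ∀ x, f (AddCircle.toCircle x) = F x) :
    ‖ContinuousMap.toLp (E := ℂ) 2 AddCircle.haarAddCircle ℂ F‖ ^ 2 =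
      (2 * π)⁻¹ * ∫ ζ, ‖f ζ‖ ^ 2 ∂arcLength := by
  have h1 := congr_arg RCLike.re (@L2.inner_def (AddCircle (2 * π)) ℂ ℂ _ _ _ _ _
    (ContinuousMap.toLp (E := ℂ) 2 AddCircle.haarAddCircle ℂ F)
    (ContinuousMap.toLp (E := ℂ) 2 AddCircle.haarAddCircle ℂ F))
  rw [← integral_re] at h1
  · simp only [← norm_sq_eq_re_inner] at h1
    have h2 := AddCircle.integral_haarAddCircle (T := 2 * π)
      (f := fun x => ‖f (AddCircle.toCircle x)‖ ^ 2)
    rw [h1, integral_arcLength_eq_addCircle]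
    refine Eq.trans ?_ h2
    refine integral_congr_ae ?_
    filter_upwards [ContinuousMap.coeFn_toLp (𝕜 := ℂ) (p := 2) AddCircle.haarAddCircle F] with x hx
    rw [hx, hf]
  · exact L2.integrable_inner _ _

/-- **Parseval's identity** on the unit circle for absolutely summable coefficients. -/
lemma hasSum_norm_sq_coeff {c : ℕ → ℂ} (hc : Summable fun n => ‖c n‖) {f : Circle → ℂ}
    (hf : ∀ ζ : Circle, HasSum (fun n => c n * (ζ : ℂ) ^ n) (f ζ)) :
    HasSum (fun n => ‖c n‖ ^ 2) ((2 * π)⁻¹ * ∫ ζ, ‖f ζ‖ ^ 2 ∂arcLength) := by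
  have h1 : Summable fun n : ℕ => c n • (fourier (n : ℤ) : C(AddCircle (2 * π), ℂ)) := by
    refine Summable.of_norm ?_
    simpa only [norm_smul, fourier_norm, mul_one] using hc
  obtain ⟨F, hF⟩ := h1
  have h2 := hF.mapL (ContinuousMap.toLp (E := ℂ) 2 AddCircle.haarAddCircle ℂ)
  simp only [map_smul] at h2
  rw [← norm_toLp_sq_eq_integral_arcLength F f]
  · exact (orthonormal_fourier.comp _ Nat.cast_injective).hasSum_norm_sq h2
  · intro x
    have h3 := hF.mapL (ContinuousMap.evalCLM ℂ x)
    refine (hf _).unique ?_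
    convert h3 using 2 with n
    · simp [fourier_apply, AddCircle.toCircle_nsmul]
    · simp

/-- The Taylor coefficients at the origin. -/
noncomputable def taylorCoeff (g : ℂ → ℂ) (n : ℕ) : ℂ := (n.factorial : ℂ)⁻¹ * iteratedDeriv n g 0

lemma hasSum_taylorCoeff {g : ℂ → ℂ} (hg : DifferentiableOn ℂ g (Metric.ball 0 1)) {z : ℂ}
    (hz : ‖z‖ < 1) : HasSum (fun n => taylorCoeff g n * z ^ n) (g z) := by
  have h := Complex.hasSum_taylorSeries_on_ball (r := 1) hg (z := z) (by simpa using hz)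
  refine h.of_eq fun n => ?_
  simp only [taylorCoeff, smul_eq_mul, sub_zero]
  ring

lemma taylorCoeff_deriv (g : ℂ → ℂ) (n : ℕ) :
    taylorCoeff (deriv g) n = (n + 1) * taylorCoeff g (n + 1) := by
  rw [taylorCoeff, taylorCoeff, iteratedDeriv_succ', Nat.factorial_succ]
  have h1 : (n.factorial : ℂ) ≠ 0 := by exact_mod_cast n.factorial_ne_zero
  have h2 : (n + 1 : ℂ) ≠ 0 := by exact_mod_cast n.succ_ne_zero
  push_cast
  field_simp

lemma norm_real_mul_circle {r : ℝ} (hr : 0 ≤ r) (ζ : Circle) : ‖(r : ℂ) * (ζ : ℂ)‖ = r := by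
  rw [norm_mul, Circle.norm_coe, mul_one, Complex.norm_real, Real.norm_of_nonneg hr]

lemma hasSum_norm_sq_taylorCoeff {g : ℂ → ℂ} (hg : DifferentiableOn ℂ g (Metric.ball 0 1)) {r : ℝ}
    (hr : 0 ≤ r) (hr1 : r < 1) :
    HasSum (fun n => ‖taylorCoeff g n‖ ^ 2 * r ^ (2 * n))
      ((2 * π)⁻¹ * ∫ ζ : Circle, ‖g (r * ζ)‖ ^ 2 ∂arcLength) := by
  have h1 : ‖(r : ℂ)‖ < 1 := by rwa [Complex.norm_real, Real.norm_of_nonneg hr]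
  have h2 := (hasSum_taylorCoeff hg h1).summable.norm
  have h3 := hasSum_norm_sq_coeff h2 (f := fun ζ => g (r * ζ)) fun ζ => by
    have := hasSum_taylorCoeff hg (z := r * ζ) (by rwa [norm_real_mul_circle hr])
    simpa only [mul_pow, mul_assoc] using this
  convert h3 using 2 with n
  rw [norm_mul, norm_pow, Complex.norm_real, Real.norm_of_nonneg hr, mul_pow, pow_mul']

/-- Riesz–Fischer supplies G in L². The Poisson integral is the inner product with a continuous
kernel, so it passes through the Fourier series, and each character reproduces z^n. -/
lemma exists_poissonIntegral_of_summable_sq {c : ℕ → ℂ} (hc : Summable fun n => ‖c n‖ ^ 2) :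
    ∃ G : Circle → ℂ, Integrable G arcLength ∧
      ∀ z : ℂ, ‖z‖ < 1 → HasSum (fun n => c n * z ^ n) (poissonIntegral G z) := by
  have hon : Orthonormal ℂ fun n : ℕ => fourierLp (T := 2 * π) 2 (n : ℤ) :=
    orthonormal_fourier.comp _ Nat.cast_injective
  obtain ⟨Φ, hΦ⟩ := (hon.orthogonalFamily.summable_iff_norm_sq_summable c).2 hc
  simp only [LinearIsometry.toSpanSingleton_apply] at hΦ
  let e := AddCircle.homeomorphCircle (T := 2 * π) (by positivity)
  let G : Circle → ℂ := fun ζ => Φ (e.symm ζ)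
  have hG : ∀ x, G (AddCircle.toCircle x) = Φ x := fun x => by
    simp only [G]
    rw [← AddCircle.homeomorphCircle_apply (T := 2 * π) (by positivity), e.symm_apply_apply]
  have hGi : Integrable G arcLength := by
    rw [← measurePreserving_toCircle.integrable_comp_emb measurableEmbedding_toCircle]
    have h1 : Integrable Φ AddCircle.haarAddCircle := (Lp.memLp Φ).integrable (by norm_num)
    have h2 : Integrable Φ (volume : Measure (AddCircle (2 * π))) := by
      rw [AddCircle.volume_eq_smul_haarAddCircle]
      exact h1.smul_measure ENNReal.ofReal_ne_top
    exact h2.congr (ae_of_all _ fun x => (hG x).symm)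
  refine ⟨G, hGi, fun z hz => ?_⟩
  let K : C(AddCircle (2 * π), ℂ) := ⟨fun x => (diskPoisson z (AddCircle.toCircle x) : ℂ),
    Complex.continuous_ofReal.comp ((continuous_diskPoisson hz).comp AddCircle.continuous_toCircle)⟩
  let k := ContinuousMap.toLp (E := ℂ) 2 AddCircle.haarAddCircle ℂ K
  have hk : ∀ (F : Lp ℂ 2 (AddCircle.haarAddCircle (T := 2 * π))) (f : Circle → ℂ),
      (∀ᵐ x ∂AddCircle.haarAddCircle, f (AddCircle.toCircle x) = F x) →
      inner ℂ k F = poissonIntegral f z := by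
    intro F f hf
    have h2 := AddCircle.integral_haarAddCircle (T := 2 * π)
      (f := fun x => diskPoisson z (AddCircle.toCircle x) • f (AddCircle.toCircle x))
    rw [L2.inner_def, poissonIntegral, integral_arcLength_eq_addCircle]
    refine Eq.trans ?_ h2
    refine integral_congr_ae ?_
    filter_upwards [ContinuousMap.coeFn_toLp (𝕜 := ℂ) (p := 2) AddCircle.haarAddCircle K, hf]
      with x hx hx2
    rw [hx2, RCLike.inner_apply, hx]
    simp [K, mul_comm]
  have h1 := hΦ.mapL (innerSL ℂ k)
  simp only [map_smul, innerSL_apply_apply, smul_eq_mul] at h1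
  rw [hk Φ G (ae_of_all _ hG)] at h1
  refine h1.of_eq fun n => ?_
  rw [hk _ (fun ζ : Circle => (ζ : ℂ) ^ n) ?_,
    poissonIntegral_of_diffContOnCl (g := fun z => z ^ n)
      (Differentiable.diffContOnCl (by fun_prop)) hz]
  filter_upwards [coeFn_fourierLp (T := 2 * π) 2 (n : ℤ)] with x hx
  rw [hx, fourier_apply, natCast_zsmul, AddCircle.toCircle_nsmul, Circle.coe_pow]

/-- Parseval on the circle of radius r bounds every weighted partial sum by C²; then r → 1 in the
finite sum. -/
lemma summable_norm_sq_taylorCoeff {g : ℂ → ℂ} (hg : DifferentiableOn ℂ g (Metric.ball 0 1))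
    {C : ℝ} (hb : ∀ z, ‖z‖ < 1 → ‖g z‖ ≤ C) : Summable fun n => ‖taylorCoeff g n‖ ^ 2 := by
  refine summable_of_sum_range_le (c := C ^ 2) (fun n => by positivity) fun N => ?_
  have h1 : ∀ r : ℝ, 0 ≤ r → r < 1 →
      ∑ n ∈ Finset.range N, ‖taylorCoeff g n‖ ^ 2 * r ^ (2 * n) ≤ C ^ 2 := by
    intro r hr hr1
    have h2 := hasSum_norm_sq_taylorCoeff hg hr hr1
    refine (sum_le_hasSum _ (fun n _ => by positivity) h2).trans ?_
    have h3 : ∫ ζ : Circle, ‖g (r * ζ)‖ ^ 2 ∂arcLength ≤ ∫ ζ : Circle, C ^ 2 ∂arcLength := by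
      refine integral_mono_of_nonneg (ae_of_all _ fun ζ => by positivity) (integrable_const _)
        (ae_of_all _ fun ζ => ?_)
      have := hb (r * ζ) (by rwa [norm_real_mul_circle hr])
      simp only
      gcongr
    rw [integral_const, Measure.real, arcLength_univ, ENNReal.toReal_ofReal (by positivity),
      smul_eq_mul] at h3
    rw [inv_mul_le_iff₀ (by positivity)]
    exact h3
  have h2 : Tendsto (fun r : ℝ => ∑ n ∈ Finset.range N, ‖taylorCoeff g n‖ ^ 2 * r ^ (2 * n))
      (𝓝[<] 1) (𝓝 (∑ n ∈ Finset.range N, ‖taylorCoeff g n‖ ^ 2 * 1 ^ (2 * n))) :=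
    (Continuous.tendsto (by fun_prop) 1).mono_left nhdsWithin_le_nhds
  simp only [one_pow, mul_one] at h2
  refine le_of_tendsto h2 ?_
  filter_upwards [Ico_mem_nhdsLT (zero_lt_one' ℝ)] with r hr using h1 r hr.1 hr.2

/-- **Fatou's theorem** for bounded holomorphic functions. -/
lemma ae_exists_radialLimit_of_bounded {g : ℂ → ℂ} (hg : DifferentiableOn ℂ g (Metric.ball 0 1))
    {C : ℝ} (hb : ∀ z, ‖z‖ < 1 → ‖g z‖ ≤ C) :
    ∀ᵐ ζ : Circle ∂arcLength, ∃ L, Tendsto (fun r : ℝ => g ((r : ℂ) * ζ)) (𝓝[<] 1) (𝓝 L) := by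
  obtain ⟨G, hG, h⟩ := exists_poissonIntegral_of_summable_sq (summable_norm_sq_taylorCoeff hg hb)
  filter_upwards [ae_tendsto_poissonIntegral hG] with ζ hζ
  refine ⟨G ζ, hζ.congr' ?_⟩
  filter_upwards [Ico_mem_nhdsLT (zero_lt_one' ℝ)] with r hr
  have hz : ‖(r : ℂ) * ζ‖ < 1 := by rw [norm_real_mul_circle hr.1]; exact hr.2
  exact (h _ hz).unique (hasSum_taylorCoeff hg hz)

/-! ### Boundary values of outer functions. -/

lemma IsOuter.exists_outerExp {f : ℂ → ℂ} (hf : IsOuter f) :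
    ∃ u : Circle → ℝ, Measurable u ∧ Integrable u arcLength ∧
      ∀ z, ‖z‖ < 1 → f z = outerExp u z := by
  obtain ⟨φ, -, hφ, h⟩ := hf
  have hm := hφ.aestronglyMeasurable
  -- A measurable representative of log φ gives the same Herglotz integral and makes Carleson's
  -- integrand measurable.
  refine ⟨hm.mk _, hm.stronglyMeasurable_mk.measurable, hφ.congr hm.ae_eq_mk, fun z hz => ?_⟩
  rw [h z (by simpa using hz), outerExp, herglotz]
  congr 2
  refine integral_congr_ae ?_
  filter_upwards [hm.ae_eq_mk] with ζ hζ
  rw [hζ]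

lemma isOuter_outerExp {u : Circle → ℝ} (hu : Integrable u arcLength) : IsOuter (outerExp u) :=
  ⟨fun ζ => Real.exp (u ζ), fun ζ => Real.exp_pos _, by simpa only [Real.log_exp] using hu,
    fun z _ => by simp only [Real.log_exp]; rfl⟩

lemma norm_real_mul_circle_lt_one {r : ℝ} (hr : r ∈ Ico (0 : ℝ) 1) (ζ : Circle) :
    ‖(r : ℂ) * (ζ : ℂ)‖ < 1 := by
  rw [norm_real_mul_circle hr.1]; exact hr.2

lemma ae_tendsto_norm_outerExp {u : Circle → ℝ} (hu : Integrable u arcLength) :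
    ∀ᵐ ζ : Circle ∂arcLength, Tendsto (fun r : ℝ => ‖outerExp u (r * ζ)‖) (𝓝[<] 1)
      (𝓝 (Real.exp (u ζ))) := by
  filter_upwards [ae_tendsto_poissonIntegral hu] with ζ hζ
  refine ((Real.continuous_exp.tendsto _).comp hζ).congr' ?_
  filter_upwards [Ico_mem_nhdsLT (zero_lt_one' ℝ)] with r hr
  rw [norm_outerExp hu (norm_real_mul_circle_lt_one hr ζ), Function.comp_apply]

lemma ae_exists_radialLimit_outerExp_of_nonpos {u : Circle → ℝ} (hu : Integrable u arcLength)
    (h0 : ∀ ζ, u ζ ≤ 0) : ∀ᵐ ζ : Circle ∂arcLength,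
      ∃ L, L ≠ 0 ∧ Tendsto (fun r : ℝ => outerExp u (r * ζ)) (𝓝[<] 1) (𝓝 L) := by
  filter_upwards [ae_tendsto_norm_outerExp hu, ae_exists_radialLimit_of_bounded
    (differentiableOn_outerExp hu) (fun z hz => norm_outerExp_le_one hu (ae_of_all _ h0) hz)]
    with ζ h1 h2
  obtain ⟨L, hL⟩ := h2
  refine ⟨L, ?_, hL⟩
  rw [← norm_ne_zero_iff, tendsto_nhds_unique hL.norm h1]
  exact (Real.exp_pos _).ne'

/-- An outer function has radial limits almost everywhere, of the prescribed modulus. -/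
lemma ae_norm_radialLimit_outerExp {f : ℂ → ℂ} {u : Circle → ℝ} (hu : Integrable u arcLength)
    (hf : ∀ z, ‖z‖ < 1 → f z = outerExp u z) :
    ∀ᵐ ζ ∂arcLength, ‖radialLimit f ζ‖ = Real.exp (u ζ) := by
  -- Writing u = (−u⁻) − (−u⁺) exhibits f as a quotient of two outer functions bounded by 1. Both
  -- have radial limits, and that of the denominator is nonzero a.e.
  have hp : Integrable (fun ζ => -max (u ζ) 0) arcLength := hu.pos_part.neg
  have hn : Integrable (fun ζ => -max (-u ζ) 0) arcLength := hu.neg_part.neg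
  filter_upwards [ae_tendsto_norm_outerExp hu,
    ae_exists_radialLimit_outerExp_of_nonpos hp (fun ζ => by simp),
    ae_exists_radialLimit_outerExp_of_nonpos hn (fun ζ => by simp)] with ζ h1 h2 h3
  obtain ⟨L₁, hL₁, h2⟩ := h2
  obtain ⟨L₂, -, h3⟩ := h3
  have h4 : Tendsto (fun r : ℝ => f (r * ζ)) (𝓝[<] 1) (𝓝 (L₂ / L₁)) := by
    refine (h3.div h2 hL₁).congr' ?_
    filter_upwards [Ico_mem_nhdsLT (zero_lt_one' ℝ)] with r hr
    have hz := norm_real_mul_circle_lt_one hr ζ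
    rw [hf _ hz, Pi.div_apply]
    simp only [outerExp]
    rw [← Complex.exp_sub, ← herglotz_sub hn hp hz]
    congr 2 with ξ
    rcases le_total (u ξ) 0 with h | h
    · rw [max_eq_right h, max_eq_left (by linarith)]; ring
    · rw [max_eq_left h, max_eq_right (by linarith)]; ring
  rw [radialLimit, h4.limUnder_eq]
  refine tendsto_nhds_unique (h4.norm.congr' ?_) h1
  filter_upwards [Ico_mem_nhdsLT (zero_lt_one' ℝ)] with r hr
  rw [hf _ (norm_real_mul_circle_lt_one hr ζ)]

/-! ### The Dirichlet integral as Σ n|a_n|². -/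

lemma lintegral_Ioo_exp_eq_arcLength {F : Circle → ℝ≥0∞} (hF : Measurable F) :
    ∫⁻ θ in Ioo (-π) π, F (Circle.exp θ) = ∫⁻ ζ, F ζ ∂arcLength := by
  rw [arcLength, lintegral_map hF (by fun_prop), Measure.restrict_congr_set Ioo_ae_eq_Ioc]

lemma lintegral_ball_eq_polar {F : ℂ → ℝ≥0∞} (hF : Measurable F) :
    ∫⁻ z in Metric.ball (0 : ℂ) 1, F z =
      ∫⁻ r in Ioo (0 : ℝ) 1, ENNReal.ofReal r * ∫⁻ ζ : Circle, F (r * ζ) ∂arcLength := by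
  rw [← lintegral_indicator Metric.isOpen_ball.measurableSet,
    ← Complex.lintegral_comp_polarCoord_symm, polarCoord_target,
    Measure.volume_eq_prod, ← Measure.prod_restrict, lintegral_prod]
  · have h1 : Ioo (0 : ℝ) 1 = Iio 1 ∩ Ioi 0 := by ext; simp [and_comm]
    rw [h1, ← Measure.restrict_restrict measurableSet_Iio,
      ← lintegral_indicator measurableSet_Iio]
    refine setLIntegral_congr_fun measurableSet_Ioi fun r hr => ?_
    have hr : 0 < r := hr
    have h2 : ∀ θ : ℝ, Complex.polarCoord.symm (r, θ) = r * (Circle.exp θ : ℂ) := fun θ => by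
      rw [Complex.polarCoord_symm_apply, Circle.coe_exp, Complex.exp_mul_I]
      push_cast
      rfl
    simp only [h2, smul_eq_mul]
    by_cases h : r < 1
    · rw [indicator_of_mem (by exact h), ← lintegral_Ioo_exp_eq_arcLength,
        ← lintegral_const_mul']
      · refine lintegral_congr fun θ => ?_
        rw [indicator_of_mem]
        simpa [abs_of_pos hr] using h
      · exact ENNReal.ofReal_ne_top
      · exact hF.comp (by fun_prop)
    · rw [indicator_of_notMem (by exact h)]
      refine (lintegral_congr fun θ => ?_).trans lintegral_zero
      rw [indicator_of_notMem, mul_zero]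
      simpa [abs_of_pos hr] using h
  · refine Measurable.aemeasurable ?_
    refine (ENNReal.measurable_ofReal.comp measurable_fst).smul ?_
    refine (hF.indicator Metric.isOpen_ball.measurableSet).comp ?_
    have : (Complex.polarCoord.symm : ℝ × ℝ → ℂ) =
        fun p => p.1 * (Real.cos p.2 + Real.sin p.2 * Complex.I) :=
      funext Complex.polarCoord_symm_apply
    rw [this]
    fun_prop

lemma lintegral_circle_norm_sq {g : ℂ → ℂ} (hg : DifferentiableOn ℂ g (Metric.ball 0 1)) {r : ℝ}
    (hr : r ∈ Ico (0 : ℝ) 1) :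
    ∫⁻ ζ : Circle, ‖g (r * ζ)‖ₑ ^ 2 ∂arcLength =
      ∑' n, ENNReal.ofReal (2 * π * (‖taylorCoeff g n‖ ^ 2 * r ^ (2 * n))) := by
  have h := (hasSum_norm_sq_taylorCoeff hg hr.1 hr.2).mul_left (2 * π)
  rw [mul_inv_cancel_left₀ (by positivity)] at h
  rw [← ENNReal.ofReal_tsum_of_nonneg (fun n => mul_nonneg (by positivity)
    (mul_nonneg (by positivity) (pow_nonneg hr.1 _))) h.summable, h.tsum_eq,
    ofReal_integral_eq_lintegral_ofReal]
  · refine lintegral_congr fun ζ => ?_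
    rw [ENNReal.ofReal_pow (norm_nonneg _), ofReal_norm]
  · have hc : Continuous fun ζ : Circle => ‖g (r * ζ)‖ ^ 2 := by
      refine Continuous.pow (Continuous.norm ?_) 2
      refine hg.continuousOn.comp_continuous (by fun_prop) fun ζ => ?_
      simpa using norm_real_mul_circle_lt_one hr ζ
    exact hc.integrable_of_hasCompactSupport (HasCompactSupport.of_compactSpace _)
  · exact ae_of_all _ fun ζ => by positivity

/-- The Dirichlet integral in terms of Taylor coefficients. -/
lemma dirichletIntegral_eq_tsum {g : ℂ → ℂ} (hg : DifferentiableOn ℂ g (Metric.ball 0 1)) :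
    dirichletIntegral g = ∑' n : ℕ, ENNReal.ofReal (n * ‖taylorCoeff g n‖ ^ 2) := by
  have hd : DifferentiableOn ℂ (deriv g) (Metric.ball 0 1) := hg.deriv Metric.isOpen_ball
  rw [dirichletIntegral, lintegral_ball_eq_polar ((measurable_deriv g).enorm.pow_const 2)]
  have h1 : ∀ r ∈ Ioo (0 : ℝ) 1, ENNReal.ofReal r * ∫⁻ ζ : Circle, ‖deriv g (r * ζ)‖ₑ ^ 2 ∂arcLength
      = ∑' n : ℕ, ENNReal.ofReal (2 * π * ((n + 1) * ‖taylorCoeff g (n + 1)‖) ^ 2) *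
        ENNReal.ofReal (r ^ (2 * n + 1)) := by
    intro r hr
    rw [lintegral_circle_norm_sq hd ⟨hr.1.le, hr.2⟩, ← ENNReal.tsum_mul_left]
    congr 1 with n
    rw [← ENNReal.ofReal_mul hr.1.le, ← ENNReal.ofReal_mul (by positivity), taylorCoeff_deriv,
      norm_mul]
    have : ‖(n + 1 : ℂ)‖ = n + 1 := by
      rw [← Nat.cast_add_one, Complex.norm_natCast]; push_cast; rfl
    rw [this]
    congr 1
    ring
  rw [setLIntegral_congr_fun measurableSet_Ioo h1, lintegral_tsum]
  -- The n = 0 term vanishes, so the series is shifted; then (1/π)·2π(n+1)²·1/(2n+2) = n+1.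
  · rw [← ENNReal.tsum_mul_left,
      tsum_eq_zero_add' (f := fun n : ℕ => ENNReal.ofReal (n * ‖taylorCoeff g n‖ ^ 2))
        ENNReal.summable]
    simp only [Nat.cast_zero]
    simp only [zero_mul, ENNReal.ofReal_zero, zero_add]
    refine tsum_congr fun n => ?_
    have h2 : ∫⁻ r in Ioo (0 : ℝ) 1, ENNReal.ofReal (r ^ (2 * n + 1)) =
        ENNReal.ofReal (1 / (2 * n + 2)) := by
      have h3 : ∫ r in Ioo (0 : ℝ) 1, r ^ (2 * n + 1) = 1 / (2 * n + 2) := by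
        rw [← integral_Ioc_eq_integral_Ioo, ← intervalIntegral.integral_of_le zero_le_one,
          integral_pow]
        push_cast
        simp
        ring
      rw [← h3, ofReal_integral_eq_lintegral_ofReal]
      · exact ((Continuous.integrableOn_Icc (by fun_prop)).mono_set Ioo_subset_Icc_self)
      · filter_upwards [ae_restrict_mem measurableSet_Ioo] with r hr
        exact pow_nonneg hr.1.le _
    rw [lintegral_const_mul' _ _ ENNReal.ofReal_ne_top, h2, ← ENNReal.ofReal_mul (by positivity),
      ← ENNReal.ofReal_mul (by positivity)]
    congr 1
    push_cast
    field_simp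
  · intro n
    exact (Measurable.aemeasurable (by fun_prop))

/-! ### The energy form of the Poisson kernel. -/

instance secondCountableTopology_circle : SecondCountableTopology Circle :=
  inferInstanceAs (SecondCountableTopology (Submonoid.unitSphere ℂ))

lemma diskPoisson_real_mul_comm (s : ℝ) (ζ ξ : Circle) :
    diskPoisson (s * ζ) ξ = diskPoisson (s * ξ) ζ := by
  simp only [diskPoisson, norm_sub_real_mul_sq, norm_mul, Circle.norm_coe,
    norm_sub_rev (ζ : ℂ) (ξ : ℂ)]

lemma continuous_diskPoisson_prod {s : ℝ} (hs : s ∈ Ico (0 : ℝ) 1) :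
    Continuous fun p : Circle × Circle => diskPoisson (s * p.1) p.2 := by
  unfold diskPoisson
  refine Continuous.div (by fun_prop) (by fun_prop) fun p => ?_
  have := circle_sub_ne_zero (norm_real_mul_circle_lt_one hs p.1) p.2
  positivity

lemma integrable_mul_diskPoisson_prod {s : ℝ} (hs : s ∈ Ico (0 : ℝ) 1) {F : Circle × Circle → ℝ}
    (hF : Integrable F (arcLength.prod arcLength)) :
    Integrable (fun p => F p * diskPoisson (s * p.1) p.2) (arcLength.prod arcLength) := by
  refine hF.mul_bdd (c := 2 / (1 - s)) (continuous_diskPoisson_prod hs).aestronglyMeasurable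
    (ae_of_all _ fun p => ?_)
  have hz := norm_real_mul_circle_lt_one hs p.1
  rw [Real.norm_of_nonneg (diskPoisson_nonneg hz _)]
  have := diskPoisson_le hz p.2
  rwa [norm_real_mul_circle hs.1] at this

section
variable {g u : Circle → ℝ} {C : ℝ}

lemma integral_fst_mul_diskPoisson {w : Circle → ℝ} (hw : Integrable w arcLength) {s : ℝ}
    (hs : s ∈ Ico (0 : ℝ) 1) :
    ∫ p, w p.1 * diskPoisson (s * p.1) p.2 ∂(arcLength.prod arcLength) =
      2 * π * ∫ ζ, w ζ ∂arcLength := by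
  rw [integral_prod _ (integrable_mul_diskPoisson_prod hs (hw.comp_fst _)), ← integral_const_mul]
  congr 1 with ζ
  dsimp only
  rw [integral_const_mul, integral_diskPoisson (norm_real_mul_circle_lt_one hs ζ), mul_comm]

lemma integral_swap_mul_diskPoisson (F : Circle × Circle → ℝ) (s : ℝ) :
    ∫ p, F p.swap * diskPoisson (s * p.1) p.2 ∂(arcLength.prod arcLength) =
      ∫ p, F p * diskPoisson (s * p.1) p.2 ∂(arcLength.prod arcLength) := by
  rw [← integral_prod_swap]
  congr 1 with p
  rw [Prod.swap_swap, Prod.fst_swap, Prod.snd_swap, diskPoisson_real_mul_comm]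

lemma integrable_cross (hg : AEStronglyMeasurable g arcLength) (hgC : ∀ᵐ ζ ∂arcLength, ‖g ζ‖ ≤ C)
    (hu : Integrable u arcLength) :
    Integrable (fun p : Circle × Circle => g p.1 * u p.2) (arcLength.prod arcLength) :=
  (hu.comp_snd arcLength).bdd_mul hg.comp_fst (Measure.quasiMeasurePreserving_fst.ae hgC)

lemma integrable_energy (hg : AEStronglyMeasurable g arcLength)
    (hgC : ∀ᵐ ζ ∂arcLength, ‖g ζ‖ ≤ C) (hu : Integrable u arcLength) :
    Integrable (fun p : Circle × Circle => (g p.1 - g p.2) * (u p.1 - u p.2))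
      (arcLength.prod arcLength) := by
  have hgu : Integrable (fun ζ => g ζ * u ζ) arcLength := hu.bdd_mul hg hgC
  have h1 := integrable_cross hg hgC hu
  refine (((hgu.comp_fst arcLength).sub h1).add
    ((hgu.comp_snd arcLength).sub h1.swap)).congr (ae_of_all _ fun p => ?_)
  simp only [Pi.add_apply, Pi.sub_apply, Function.comp_apply, Prod.fst_swap, Prod.snd_swap]
  ring

/-- The energy form of the Poisson semigroup as a double integral. -/
lemma integral_energy_diskPoisson (hg : AEStronglyMeasurable g arcLength)
    (hgC : ∀ᵐ ζ ∂arcLength, ‖g ζ‖ ≤ C) (hu : Integrable u arcLength) {s : ℝ}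
    (hs : s ∈ Ico (0 : ℝ) 1) :
    ∫ p, (g p.1 - g p.2) * (u p.1 - u p.2) * diskPoisson (s * p.1) p.2
        ∂(arcLength.prod arcLength) =
      4 * π * (∫ ζ, g ζ * u ζ ∂arcLength -
        ∫ ζ, g ζ * poissonIntegral u (s * ζ) ∂arcLength) := by
  have hgu : Integrable (fun ζ => g ζ * u ζ) arcLength := hu.bdd_mul hg hgC
  have h1 := integrable_cross hg hgC hu
  have i1 := integrable_mul_diskPoisson_prod hs (hgu.comp_fst arcLength)
  have i2 := integrable_mul_diskPoisson_prod hs (hgu.comp_snd arcLength)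
  have i3 := integrable_mul_diskPoisson_prod hs h1
  have i4 := integrable_mul_diskPoisson_prod hs h1.swap
  have e1 := integral_fst_mul_diskPoisson hgu hs
  have e2 := integral_swap_mul_diskPoisson (fun p => g p.1 * u p.1) s
  have e3 : ∫ p, g p.1 * u p.2 * diskPoisson (s * p.1) p.2 ∂(arcLength.prod arcLength) =
      2 * π * ∫ ζ, g ζ * poissonIntegral u (s * ζ) ∂arcLength := by
    rw [integral_prod _ i3, ← integral_const_mul]
    congr 1 with ζ
    simp only [poissonIntegral, smul_eq_mul]
    rw [mul_left_comm (g ζ), mul_inv_cancel_left₀ (by positivity), ← integral_const_mul]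
    congr 1 with ξ
    ring
  have e4 := integral_swap_mul_diskPoisson (fun p => g p.1 * u p.2) s
  simp only [Prod.fst_swap, Prod.snd_swap, Function.comp_apply] at e2 e4 i2 i4
  -- The expansion has two diagonal and two cross terms. By symmetry of the kernel they agree in
  -- pairs, and each contributes 2π, whence the factor 4π.
  have key : ∀ p : Circle × Circle,
      (g p.1 - g p.2) * (u p.1 - u p.2) * diskPoisson (s * p.1) p.2 =
      (g p.1 * u p.1 * diskPoisson (s * p.1) p.2 + g p.2 * u p.2 * diskPoisson (s * p.1) p.2) -
      (g p.1 * u p.2 * diskPoisson (s * p.1) p.2 + g p.2 * u p.1 * diskPoisson (s * p.1) p.2) :=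
    fun p => by ring
  simp only [key]
  have e5 := integral_sub (i1.add i2) (i3.add i4)
  rw [integral_add' i1 i2, integral_add' i3 i4, e2, e4, e1, e3] at e5
  refine e5.trans ?_
  ring
end

/-! ### Carleson's formula: the upper bound. -/

/-- The integrand of Carleson's formula for the Dirichlet integral of an outer function. -/
noncomputable def carlesonIntegrand (u : Circle → ℝ) (p : Circle × Circle) : ℝ :=
  (Real.exp (2 * u p.1) - Real.exp (2 * u p.2)) * (u p.1 - u p.2) / ‖(p.1 : ℂ) - p.2‖ ^ 2

/-- The double integral of Carleson's formula. -/
noncomputable def carlesonEnergy (u : Circle → ℝ) : ℝ≥0∞ :=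
  ∫⁻ p, ENNReal.ofReal (carlesonIntegrand u p) ∂(arcLength.prod arcLength)

lemma exp_sub_exp_mul_sub_nonneg (a b : ℝ) :
    0 ≤ (Real.exp (2 * a) - Real.exp (2 * b)) * (a - b) := by
  rcases le_total a b with h | h
  · exact mul_nonneg_of_nonpos_of_nonpos (sub_nonpos.2 (Real.exp_le_exp.2 (by linarith)))
      (by linarith)
  · exact mul_nonneg (sub_nonneg.2 (Real.exp_le_exp.2 (by linarith))) (by linarith)

lemma carlesonIntegrand_nonneg (u : Circle → ℝ) (p : Circle × Circle) :
    0 ≤ carlesonIntegrand u p :=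
  div_nonneg (exp_sub_exp_mul_sub_nonneg _ _) (by positivity)

lemma measurable_carlesonIntegrand {u : Circle → ℝ} (hu : Measurable u) :
    Measurable (carlesonIntegrand u) := by
  unfold carlesonIntegrand
  have h1 : Measurable fun p : Circle × Circle => u p.1 := hu.comp measurable_fst
  have h2 : Measurable fun p : Circle × Circle => u p.2 := hu.comp measurable_snd
  have h3 : Measurable fun p : Circle × Circle => ‖(p.1 : ℂ) - p.2‖ ^ 2 :=
    Continuous.measurable (by fun_prop)
  fun_prop

/-- Tangent-line inequality for exp. With a = u and b = P_s u it serves the upper bound in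
Carleson's formula, and with the roles exchanged the lower bound. -/
lemma exp_sub_exp_le (a b : ℝ) :
    Real.exp (2 * a) - Real.exp (2 * b) ≤ 2 * (Real.exp (2 * a) * (a - b)) := by
  have h := Real.add_one_le_exp (2 * b - 2 * a)
  have h2 : Real.exp (2 * b) = Real.exp (2 * a) * Real.exp (2 * b - 2 * a) := by
    rw [← Real.exp_add]; congr 1; ring
  nlinarith [Real.exp_pos (2 * a), mul_le_mul_of_nonneg_left h (Real.exp_pos (2 * a)).le]

/-- The integral of `|f|²` over the circle of radius `r`. -/
noncomputable def circleSq (f : ℂ → ℂ) (r : ℝ) : ℝ := ∫ ζ : Circle, ‖f (r * ζ)‖ ^ 2 ∂arcLength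

lemma hasSum_circleSq {g : ℂ → ℂ} (hg : DifferentiableOn ℂ g (Metric.ball 0 1)) {r : ℝ}
    (hr : r ∈ Ico (0 : ℝ) 1) :
    HasSum (fun n => 2 * π * (‖taylorCoeff g n‖ ^ 2 * r ^ (2 * n))) (circleSq g r) := by
  have h := (hasSum_norm_sq_taylorCoeff hg hr.1 hr.2).mul_left (2 * π)
  rwa [mul_inv_cancel_left₀ (by positivity)] at h

lemma continuous_comp_real_mul_circle {g : ℂ → ℂ} (hg : DifferentiableOn ℂ g (Metric.ball 0 1))
    {r : ℝ} (hr : r ∈ Ico (0 : ℝ) 1) : Continuous fun ζ : Circle => g (r * ζ) :=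
  hg.continuousOn.comp_continuous (by fun_prop) fun ζ => by
    simpa using norm_real_mul_circle_lt_one hr ζ

lemma Continuous.integrable_arcLength {E : Type*} [NormedAddCommGroup E] {F : Circle → E}
    (hF : Continuous F) : Integrable F arcLength :=
  hF.integrable_of_hasCompactSupport (HasCompactSupport.of_compactSpace _)

lemma tendsto_circleSq_outerExp {u : Circle → ℝ} (hu : Integrable u arcLength)
    (h0 : ∀ᵐ ζ ∂arcLength, u ζ ≤ 0) :
    Tendsto (circleSq (outerExp u)) (𝓝[<] 1) (𝓝 (∫ ζ, Real.exp (2 * u ζ) ∂arcLength)) := by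
  refine tendsto_integral_filter_of_dominated_convergence (fun _ => 1) ?_ ?_ (integrable_const _) ?_
  · filter_upwards [Ico_mem_nhdsLT (zero_lt_one' ℝ)] with r hr
    exact ((continuous_comp_real_mul_circle (differentiableOn_outerExp hu) hr).norm.pow
      2).aestronglyMeasurable
  · filter_upwards [Ico_mem_nhdsLT (zero_lt_one' ℝ)] with r hr
    refine ae_of_all _ fun ζ => ?_
    rw [Real.norm_of_nonneg (by positivity)]
    exact pow_le_one₀ (norm_nonneg _)
      (norm_outerExp_le_one hu h0 (norm_real_mul_circle_lt_one hr ζ))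
  · filter_upwards [ae_tendsto_norm_outerExp hu] with ζ hζ
    have := hζ.pow 2
    rwa [← Real.exp_nat_mul] at this

lemma sum_taylorCoeff_le_circleSq_sub {g : ℂ → ℂ} (hg : DifferentiableOn ℂ g (Metric.ball 0 1))
    {s r : ℝ} (hs : 0 ≤ s) (hsr : s ≤ r) (hr : r < 1) (N : ℕ) :
    ∑ n ∈ Finset.range N, 2 * π * (‖taylorCoeff g n‖ ^ 2 * (r ^ (2 * n) - s ^ (2 * n))) ≤
      circleSq g r - circleSq g s := by
  have h := (hasSum_circleSq hg ⟨hs.trans hsr, hr⟩).sub (hasSum_circleSq hg ⟨hs, hsr.trans_lt hr⟩)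
  simp only [← mul_sub] at h
  refine sum_le_hasSum _ (fun n _ => ?_) h
  have : s ^ (2 * n) ≤ r ^ (2 * n) := by gcongr
  have : 0 ≤ r ^ (2 * n) - s ^ (2 * n) := by linarith
  positivity

/-- Fatou's lemma in the form where the bounds on the integrals also converge. -/
lemma lintegral_le_of_tendsto_of_le {α : Type*} [MeasurableSpace α] {μ : Measure α}
    {f : ℕ → α → ℝ≥0∞} {F : α → ℝ≥0∞} {c : ℕ → ℝ≥0∞} {C : ℝ≥0∞} (hf : ∀ k, Measurable (f k))
    (hF : ∀ᵐ x ∂μ, Tendsto (fun k => f k x) atTop (𝓝 (F x))) (hc : ∀ k, ∫⁻ x, f k x ∂μ ≤ c k)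
    (hC : Tendsto c atTop (𝓝 C)) : ∫⁻ x, F x ∂μ ≤ C :=
  calc ∫⁻ x, F x ∂μ = ∫⁻ x, liminf (fun k => f k x) atTop ∂μ := by
        refine lintegral_congr_ae ?_
        filter_upwards [hF] with x hx using hx.liminf_eq.symm
    _ ≤ liminf (fun k => ∫⁻ x, f k x ∂μ) atTop := lintegral_liminf_le hf
    _ ≤ liminf c atTop := liminf_le_liminf (Eventually.of_forall hc)
    _ = C := hC.liminf_eq

/-- The term (1−s)² in the denominator is dropped. -/
lemma diskPoisson_le_div {s : ℝ} (hs : s ∈ Ioo (0 : ℝ) 1) {ζ ξ : Circle} (h : ζ ≠ ξ) :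
    diskPoisson (s * ζ) ξ ≤ (1 - s ^ 2) / s * (‖(ζ : ℂ) - ξ‖ ^ 2)⁻¹ := by
  have h1 : (ζ : ℂ) - ξ ≠ 0 := sub_ne_zero.2 fun h2 => h (Circle.ext h2)
  have h2 : 0 < ‖(ζ : ℂ) - ξ‖ ^ 2 := by positivity
  have h3 : 0 ≤ 1 - s ^ 2 := by nlinarith [hs.1, hs.2]
  have h4 := hs.1
  rw [diskPoisson, norm_sub_real_mul_sq, norm_real_mul_circle hs.1.le, div_mul_eq_mul_div,
    ← div_eq_mul_inv, div_div, mul_comm _ s]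
  gcongr
  nlinarith [sq_nonneg (1 - s)]

section
variable {u : Circle → ℝ}

lemma norm_exp_two_mul_le_one (h0 : ∀ᵐ ζ ∂arcLength, u ζ ≤ 0) :
    ∀ᵐ ζ ∂arcLength, ‖Real.exp (2 * u ζ)‖ ≤ 1 := by
  filter_upwards [h0] with ζ hζ
  rw [Real.norm_of_nonneg (Real.exp_pos _).le, Real.exp_le_one_iff]
  linarith

lemma energy_diskPoisson_le (hum : Measurable u) (hu : Integrable u arcLength)
    (h0 : ∀ᵐ ζ ∂arcLength, u ζ ≤ 0) (hJ : carlesonEnergy u ≠ ⊤) {s : ℝ} (hs : s ∈ Ioo (0 : ℝ) 1) :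
    4 * π * (∫ ζ, Real.exp (2 * u ζ) * u ζ ∂arcLength -
        ∫ ζ, Real.exp (2 * u ζ) * poissonIntegral u (s * ζ) ∂arcLength) ≤
      (1 - s ^ 2) / s * (carlesonEnergy u).toReal := by
  have hs' : s ∈ Ico (0 : ℝ) 1 := ⟨hs.1.le, hs.2⟩
  have hgm : Measurable fun ζ => Real.exp (2 * u ζ) := by fun_prop
  have hb := norm_exp_two_mul_le_one h0
  rw [← integral_energy_diskPoisson hgm.aestronglyMeasurable hb hu hs']
  have h3 : 0 ≤ (1 - s ^ 2) / s := div_nonneg (by nlinarith [hs.1, hs.2]) hs.1.le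
  rw [← ENNReal.ofReal_le_ofReal_iff (by positivity), ENNReal.ofReal_mul h3,
    ENNReal.ofReal_toReal hJ, ofReal_integral_eq_lintegral_ofReal, carlesonEnergy,
    ← lintegral_const_mul']
  · refine lintegral_mono fun p => ?_
    rw [← ENNReal.ofReal_mul h3]
    apply ENNReal.ofReal_le_ofReal
    -- On the diagonal both sides vanish, Carleson's integrand being 0/0 = 0.
    by_cases hp : p.1 = p.2
    · simp [hp, carlesonIntegrand]
    · rw [carlesonIntegrand, div_eq_mul_inv (_ * _), mul_left_comm]
      exact mul_le_mul_of_nonneg_left (diskPoisson_le_div hs hp) (exp_sub_exp_mul_sub_nonneg _ _)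
  · exact ENNReal.ofReal_ne_top
  · exact integrable_mul_diskPoisson_prod hs' (integrable_energy hgm.aestronglyMeasurable hb hu)
  · exact ae_of_all _ fun p => mul_nonneg (exp_sub_exp_mul_sub_nonneg _ _)
      (diskPoisson_nonneg (norm_real_mul_circle_lt_one hs' _) _)

lemma continuous_poissonIntegral_real_mul_circle (hu : Integrable u arcLength) {s : ℝ}
    (hs : s ∈ Ico (0 : ℝ) 1) : Continuous fun ζ : Circle => poissonIntegral u (s * ζ) := by
  have h := continuous_comp_real_mul_circle (differentiableOn_herglotz hu) hs
  refine (Complex.continuous_re.comp h).congr fun ζ => ?_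
  rw [Function.comp_apply, re_herglotz hu (norm_real_mul_circle_lt_one hs ζ)]

lemma norm_outerExp_sq (hu : Integrable u arcLength) {z : ℂ} (hz : ‖z‖ < 1) :
    ‖outerExp u z‖ ^ 2 = Real.exp (2 * poissonIntegral u z) := by
  rw [norm_outerExp hu hz, ← Real.exp_nat_mul]
  rfl

lemma exp_integral_sub_circleSq_le (hum : Measurable u) (hu : Integrable u arcLength)
    (h0 : ∀ᵐ ζ ∂arcLength, u ζ ≤ 0) {s : ℝ} (hs : s ∈ Ico (0 : ℝ) 1) :
    ∫ ζ, Real.exp (2 * u ζ) ∂arcLength - circleSq (outerExp u) s ≤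
      2 * (∫ ζ, Real.exp (2 * u ζ) * u ζ ∂arcLength -
        ∫ ζ, Real.exp (2 * u ζ) * poissonIntegral u (s * ζ) ∂arcLength) := by
  have hgm : Measurable fun ζ => Real.exp (2 * u ζ) := by fun_prop
  have hb := norm_exp_two_mul_le_one h0
  have hg : Integrable (fun ζ => Real.exp (2 * u ζ)) arcLength :=
    (integrable_const (1 : ℝ)).mono' hgm.aestronglyMeasurable hb
  have h1 := hu.bdd_mul hgm.aestronglyMeasurable hb
  have h2 := (continuous_poissonIntegral_real_mul_circle hu hs).integrable_arcLength.bdd_mul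
    hgm.aestronglyMeasurable hb
  have h3 : Integrable (fun ζ : Circle => ‖outerExp u (s * ζ)‖ ^ 2) arcLength :=
    ((continuous_comp_real_mul_circle (differentiableOn_outerExp hu) hs).norm.pow
      2).integrable_arcLength
  rw [circleSq, ← integral_sub hg h3, ← integral_sub h1 h2, ← integral_const_mul]
  refine integral_mono (hg.sub h3) ((h1.sub h2).const_mul 2) fun ζ => ?_
  simp only
  rw [norm_outerExp_sq hu (norm_real_mul_circle_lt_one hs ζ), ← mul_sub]
  exact exp_sub_exp_le _ _

lemma sum_taylorCoeff_outerExp_le (hu : Integrable u arcLength)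
    (h0 : ∀ᵐ ζ ∂arcLength, u ζ ≤ 0) {s : ℝ} (hs : s ∈ Ico (0 : ℝ) 1) (N : ℕ) :
    ∑ n ∈ Finset.range N, 2 * π * (‖taylorCoeff (outerExp u) n‖ ^ 2 * (1 - s ^ (2 * n))) ≤
      ∫ ζ, Real.exp (2 * u ζ) ∂arcLength - circleSq (outerExp u) s := by
  have h1 := (tendsto_circleSq_outerExp hu h0).sub_const (circleSq (outerExp u) s)
  have h2 : Tendsto (fun r : ℝ => ∑ n ∈ Finset.range N,
      2 * π * (‖taylorCoeff (outerExp u) n‖ ^ 2 * (r ^ (2 * n) - s ^ (2 * n)))) (𝓝[<] 1)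
      (𝓝 (∑ n ∈ Finset.range N,
      2 * π * (‖taylorCoeff (outerExp u) n‖ ^ 2 * (1 ^ (2 * n) - s ^ (2 * n))))) :=
    (Continuous.tendsto (by fun_prop) 1).mono_left nhdsWithin_le_nhds
  simp only [one_pow] at h2
  refine le_of_tendsto_of_tendsto h2 h1 ?_
  filter_upwards [Ico_mem_nhdsLT hs.2] with r hr
  exact sum_taylorCoeff_le_circleSq_sub (differentiableOn_outerExp hu) hs.1 hr.1 hr.2 N

lemma sum_nat_mul_taylorCoeff_le (hum : Measurable u) (hu : Integrable u arcLength)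
    (h0 : ∀ᵐ ζ ∂arcLength, u ζ ≤ 0) (hJ : carlesonEnergy u ≠ ⊤) (N : ℕ) :
    ∑ n ∈ Finset.range N, n * ‖taylorCoeff (outerExp u) n‖ ^ 2 ≤
      1 / (4 * π ^ 2) * (carlesonEnergy u).toReal := by
  set a := fun n => ‖taylorCoeff (outerExp u) n‖ ^ 2
  have h1 : ∀ s ∈ Ioo (0 : ℝ) 1, ∑ n ∈ Finset.range N, a n * ∑ k ∈ Finset.range n, (s ^ 2) ^ k ≤
      1 / (4 * π ^ 2) * (carlesonEnergy u).toReal / s := by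
    intro s hs
    have hs' : s ∈ Ico (0 : ℝ) 1 := ⟨hs.1.le, hs.2⟩
    have e1 := sum_taylorCoeff_outerExp_le hu h0 hs' N
    have e2 := exp_integral_sub_circleSq_le hum hu h0 hs'
    have e3 := energy_diskPoisson_le hum hu h0 hJ hs
    have h3 : 0 < 1 - s ^ 2 := by nlinarith [hs.1, hs.2]
    -- The factor 1 − s² is extracted by the geometric sum, whose value at s = 1 is n; this is how Σ
    -- n|a_n|² appears in the limit.
    have e4 : ∑ n ∈ Finset.range N, 2 * π * (a n * (1 - s ^ (2 * n))) =
        2 * π * (1 - s ^ 2) * ∑ n ∈ Finset.range N, a n * ∑ k ∈ Finset.range n, (s ^ 2) ^ k := by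
      rw [Finset.mul_sum]
      refine Finset.sum_congr rfl fun n _ => ?_
      rw [pow_mul, ← mul_neg_geom_sum]
      ring
    rw [e4] at e1
    have e5 : (1 - s ^ 2) *
        (4 * π ^ 2 * ∑ n ∈ Finset.range N, a n * ∑ k ∈ Finset.range n, (s ^ 2) ^ k) ≤
        (1 - s ^ 2) * ((carlesonEnergy u).toReal / s) := by
      calc _ = 2 * π * (2 * π * (1 - s ^ 2) *
              ∑ n ∈ Finset.range N, a n * ∑ k ∈ Finset.range n, (s ^ 2) ^ k) := by ring
        _ ≤ 2 * π * (2 * (∫ ζ, Real.exp (2 * u ζ) * u ζ ∂arcLength -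
              ∫ ζ, Real.exp (2 * u ζ) * poissonIntegral u (s * ζ) ∂arcLength)) := by
            exact mul_le_mul_of_nonneg_left (e1.trans e2) (by positivity)
        _ ≤ _ := by
            refine le_trans (le_of_eq ?_) (e3.trans (le_of_eq ?_)) <;> ring
    have e6 := le_of_mul_le_mul_left e5 h3
    rw [mul_div_assoc, one_div, ← div_eq_inv_mul, le_div_iff₀ (by positivity), mul_comm]
    exact e6
  have h2 : Tendsto (fun s : ℝ => ∑ n ∈ Finset.range N, a n * ∑ k ∈ Finset.range n, (s ^ 2) ^ k)
      (𝓝[<] 1) (𝓝 (∑ n ∈ Finset.range N, a n * ∑ k ∈ Finset.range n, ((1 : ℝ) ^ 2) ^ k)) :=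
    (Continuous.tendsto (by fun_prop) 1).mono_left nhdsWithin_le_nhds
  have h3 : Tendsto (fun s : ℝ => 1 / (4 * π ^ 2) * (carlesonEnergy u).toReal / s)
      (𝓝[<] 1) (𝓝 (1 / (4 * π ^ 2) * (carlesonEnergy u).toReal / 1)) :=
    ((tendsto_const_nhds.div tendsto_id one_ne_zero)).mono_left nhdsWithin_le_nhds
  have h4 := le_of_tendsto_of_tendsto h2 h3 (by
    filter_upwards [Ioo_mem_nhdsLT (zero_lt_one' ℝ)] with s hs using h1 s hs)
  simp only [one_pow, Finset.sum_const, Finset.card_range, nsmul_eq_mul, mul_one, div_one] at h4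
  simpa only [mul_comm] using h4

/-- The upper bound in Carleson's formula. -/
theorem dirichletIntegral_outerExp_le (hum : Measurable u) (hu : Integrable u arcLength)
    (h0 : ∀ᵐ ζ ∂arcLength, u ζ ≤ 0) :
    dirichletIntegral (outerExp u) ≤ ENNReal.ofReal (1 / (4 * π ^ 2)) * carlesonEnergy u := by
  by_cases hJ : carlesonEnergy u = ⊤
  · rw [hJ, ENNReal.mul_top]
    · exact le_top
    · rw [ne_eq, ENNReal.ofReal_eq_zero, not_le]; positivity
  rw [dirichletIntegral_eq_tsum (differentiableOn_outerExp hu), ← ENNReal.ofReal_toReal hJ,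
    ← ENNReal.ofReal_mul (by positivity)]
  refine ENNReal.tsum_le_of_sum_range_le fun N => ?_
  rw [← ENNReal.ofReal_sum_of_nonneg fun n _ => by positivity]
  exact ENNReal.ofReal_le_ofReal (sum_nat_mul_taylorCoeff_le hum hu h0 hJ N)
end

/-! ### Carleson's formula: the lower bound. -/

lemma poissonIntegral_re {g : ℂ → ℂ} (hg : DifferentiableOn ℂ g (Metric.closedBall 0 1)) {z : ℂ}
    (hz : ‖z‖ < 1) : poissonIntegral (fun ζ : Circle => (g ζ).re) z = (g z).re := by
  have hgc : Continuous fun ζ : Circle => g ζ :=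
    hg.continuousOn.comp_continuous (by fun_prop) fun ζ => by simp [Circle.norm_coe]
  have h1 := poissonIntegral_of_diffContOnCl
    (DifferentiableOn.diffContOnCl (by rwa [closure_ball _ one_ne_zero])) hz
  have h2 := integral_re (𝕜 := ℂ) (integrable_diskPoisson_smul hz hgc.integrable_arcLength)
  simp only [RCLike.re_eq_complex_re, Complex.smul_re] at h2
  rw [← h1, poissonIntegral, h2, poissonIntegral, Complex.smul_re]

section
variable {u : Circle → ℝ}

/-- The restriction of the Poisson integral to the circle of radius `r`. -/
noncomputable def poissonDilate (u : Circle → ℝ) (r : ℝ) (ζ : Circle) : ℝ :=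
  poissonIntegral u (r * ζ)

lemma continuous_poissonDilate (hu : Integrable u arcLength) {r : ℝ} (hr : r ∈ Ico (0 : ℝ) 1) :
    Continuous (poissonDilate u r) :=
  continuous_poissonIntegral_real_mul_circle hu hr

lemma poissonDilate_nonpos (h0 : ∀ᵐ ζ ∂arcLength, u ζ ≤ 0) {r : ℝ} (hr : r ∈ Ico (0 : ℝ) 1)
    (ζ : Circle) : poissonDilate u r ζ ≤ 0 :=
  poissonIntegral_nonpos h0 (norm_real_mul_circle_lt_one hr ζ)

lemma mul_mem_Ico {r s : ℝ} (hr : r ∈ Ico (0 : ℝ) 1) (hs : s ∈ Ico (0 : ℝ) 1) :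
    r * s ∈ Ico (0 : ℝ) 1 :=
  ⟨mul_nonneg hr.1 hs.1, mul_lt_one_of_nonneg_of_lt_one_left hr.1 hr.2 hs.2.le⟩

/-- The semigroup law of the Poisson operators: z ↦ `herglotz u (r * z)` is holomorphic on the
closed disk, so its real part is reproduced from its boundary values. -/
lemma poissonIntegral_poissonDilate (hu : Integrable u arcLength) {r s : ℝ}
    (hr : r ∈ Ico (0 : ℝ) 1) (hs : s ∈ Ico (0 : ℝ) 1) (ζ : Circle) :
    poissonIntegral (poissonDilate u r) (s * ζ) = poissonDilate u (r * s) ζ := by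
  have hmaps : ∀ z ∈ Metric.closedBall (0 : ℂ) 1, ‖(r : ℂ) * z‖ < 1 := by
    intro z hz
    rw [norm_mul, Complex.norm_real, Real.norm_of_nonneg hr.1]
    have : ‖z‖ ≤ 1 := by simpa using hz
    nlinarith [hr.1, hr.2, norm_nonneg z]
  have hg : DifferentiableOn ℂ (fun z => herglotz u (r * z)) (Metric.closedBall 0 1) :=
    (differentiableOn_herglotz hu).comp (by fun_prop) fun z hz => by simpa using hmaps z hz
  have hz := norm_real_mul_circle_lt_one hs ζ
  have h := poissonIntegral_re hg hz
  have h1 : (fun ξ : Circle => (herglotz u (r * ξ)).re) = poissonDilate u r := funext fun ξ =>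
    re_herglotz hu (norm_real_mul_circle_lt_one hr ξ)
  rw [h1] at h
  rw [h, re_herglotz hu (hmaps _ (by simpa using hz.le)), poissonDilate]
  push_cast
  rw [mul_assoc]

/-- The derivative of the Herglotz integral is bounded on the closed disk of radius r < 1. The
constant depends on r, but not on s. -/
lemma exists_abs_poissonDilate_sub_le (hu : Integrable u arcLength) {r : ℝ}
    (hr : r ∈ Ico (0 : ℝ) 1) : ∃ C, 0 ≤ C ∧ ∀ s ∈ Ico (0 : ℝ) 1, ∀ ζ,
      |poissonDilate u r ζ - poissonDilate u (r * s) ζ| ≤ C * (1 - s) := by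
  have hsub : Metric.closedBall (0 : ℂ) r ⊆ Metric.ball 0 1 :=
    Metric.closedBall_subset_ball hr.2
  have hd := differentiableOn_herglotz hu
  obtain ⟨C, hC⟩ := (isCompact_closedBall (0 : ℂ) r).exists_bound_of_continuousOn
    ((hd.deriv Metric.isOpen_ball).continuousOn.mono hsub)
  have hC0 : 0 ≤ C := (norm_nonneg _).trans (hC 0 (by simpa using hr.1))
  refine ⟨C, hC0, fun s hs ζ => ?_⟩
  have h1 := norm_real_mul_circle_lt_one hr ζ
  have h2 := norm_real_mul_circle_lt_one (mul_mem_Ico hr hs) ζ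
  have h3 := (convex_closedBall (0 : ℂ) r).norm_image_sub_le_of_norm_deriv_le
    (fun z hz => (hd.differentiableAt (Metric.isOpen_ball.mem_nhds (hsub hz)))) hC
    (x := ((r * s : ℝ) : ℂ) * ζ) (y := (r : ℂ) * ζ)
    (by rw [mem_closedBall_zero_iff, norm_real_mul_circle (mul_mem_Ico hr hs).1]
        nlinarith [hr.1, hs.2])
    (by rw [mem_closedBall_zero_iff, norm_real_mul_circle hr.1])
  have h4 : ‖(r : ℂ) * ζ - ((r * s : ℝ) : ℂ) * ζ‖ ≤ 1 - s := by
    have : (r : ℂ) * ζ - ((r * s : ℝ) : ℂ) * ζ = ((r * (1 - s) : ℝ) : ℂ) * ζ := by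
      push_cast; ring
    rw [this, norm_real_mul_circle (mul_nonneg hr.1 (by linarith [hs.2]))]
    nlinarith [hr.1, hr.2, hs.2]
  rw [poissonDilate, poissonDilate, ← re_herglotz hu h1, ← re_herglotz hu h2, ← Complex.sub_re]
  exact (Complex.abs_re_le_norm _).trans (h3.trans (mul_le_mul_of_nonneg_left h4 hC0))

lemma abs_exp_sub_exp_le {a b : ℝ} (ha : a ≤ 0) (hb : b ≤ 0) :
    |Real.exp (2 * a) - Real.exp (2 * b)| ≤ 2 * |a - b| := by
  wlog h : b ≤ a generalizing a b
  · rw [abs_sub_comm, abs_sub_comm a b]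
    exact this hb ha (le_of_not_ge h)
  rw [abs_of_nonneg (sub_nonneg.2 (Real.exp_le_exp.2 (by linarith))), abs_of_nonneg (by linarith)]
  have h1 := exp_sub_exp_le a b
  have h2 : Real.exp (2 * a) ≤ 1 := Real.exp_le_one_iff.2 (by linarith)
  nlinarith

lemma circleSq_outerExp (hu : Integrable u arcLength) {r : ℝ} (hr : r ∈ Ico (0 : ℝ) 1) :
    circleSq (outerExp u) r = ∫ ζ, Real.exp (2 * poissonDilate u r ζ) ∂arcLength := by
  rw [circleSq]
  congr 1 with ζ
  rw [norm_outerExp_sq hu (norm_real_mul_circle_lt_one hr ζ), poissonDilate]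

lemma energy_poissonDilate_le (hu : Integrable u arcLength) (h0 : ∀ᵐ ζ ∂arcLength, u ζ ≤ 0) {r : ℝ}
    (hr : r ∈ Ico (0 : ℝ) 1) : ∃ C, ∀ s ∈ Ico (0 : ℝ) 1,
      ∫ p, (Real.exp (2 * poissonDilate u r p.1) - Real.exp (2 * poissonDilate u r p.2)) *
        (poissonDilate u r p.1 - poissonDilate u r p.2) * diskPoisson (s * p.1) p.2
          ∂(arcLength.prod arcLength) ≤
      C * (1 - s) ^ 2 + 2 * π * (circleSq (outerExp u) r - circleSq (outerExp u) (r * s)) := by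
  obtain ⟨C, hC0, hC⟩ := exists_abs_poissonDilate_sub_le hu hr
  refine ⟨4 * π * (2 * π) * (2 * C ^ 2), fun s hs => ?_⟩
  have hrs := mul_mem_Ico hr hs
  set v := poissonDilate u r with hv
  set w := poissonDilate u (r * s) with hw
  have hvc : Continuous v := continuous_poissonDilate hu hr
  have hwc : Continuous w := continuous_poissonDilate hu hrs
  have hv0 : ∀ ζ, v ζ ≤ 0 := poissonDilate_nonpos h0 hr
  have hw0 : ∀ ζ, w ζ ≤ 0 := poissonDilate_nonpos h0 hrs
  have hgc : Continuous fun ζ => Real.exp (2 * v ζ) := by fun_prop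
  rw [integral_energy_diskPoisson (g := fun ζ => Real.exp (2 * v ζ)) hgc.aestronglyMeasurable
    (norm_exp_two_mul_le_one (ae_of_all _ hv0)) hvc.integrable_arcLength hs]
  simp only [hv, poissonIntegral_poissonDilate hu hr hs]
  simp only [← hv, ← hw]
  rw [circleSq_outerExp hu hr, circleSq_outerExp hu hrs, ← hv, ← hw,
    ← integral_sub (Continuous.integrable_arcLength (by fun_prop))
      (Continuous.integrable_arcLength (by fun_prop)),
    ← integral_sub (Continuous.integrable_arcLength (by fun_prop))
      (Continuous.integrable_arcLength (by fun_prop))]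
  have h1 : ∫ ζ, (Real.exp (2 * v ζ) * v ζ - Real.exp (2 * v ζ) * w ζ) ∂arcLength ≤
      ∫ ζ, (2 * C ^ 2 * (1 - s) ^ 2 +
        1 / 2 * (Real.exp (2 * v ζ) - Real.exp (2 * w ζ))) ∂arcLength := by
    refine integral_mono (Continuous.integrable_arcLength (by fun_prop))
      (Continuous.integrable_arcLength (by fun_prop)) fun ζ => ?_
    simp only
    -- Split e^{2v}(v−w) as e^{2w}(v−w) + (e^{2v}−e^{2w})(v−w). Convexity bounds the first term by
    -- ½(e^{2v}−e^{2w}), and the second is quadratic in 1−s.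
    have h2 := exp_sub_exp_le (w ζ) (v ζ)
    have h3 := hC s hs ζ
    have h4 : |Real.exp (2 * v ζ) - Real.exp (2 * w ζ)| ≤ 2 * (C * (1 - s)) :=
      (abs_exp_sub_exp_le (hv0 ζ) (hw0 ζ)).trans (mul_le_mul_of_nonneg_left h3 zero_le_two)
    have h5 : (Real.exp (2 * v ζ) - Real.exp (2 * w ζ)) * (v ζ - w ζ) ≤
        2 * (C * (1 - s)) * (C * (1 - s)) := by
      refine (le_abs_self _).trans ?_
      rw [abs_mul]
      exact mul_le_mul h4 h3 (abs_nonneg _) ((abs_nonneg _).trans h4)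
    nlinarith
  rw [integral_add (integrable_const _) (Continuous.integrable_arcLength (by fun_prop)),
    integral_const, Measure.real, arcLength_univ, ENNReal.toReal_ofReal (by positivity),
    smul_eq_mul, integral_const_mul] at h1
  have := mul_le_mul_of_nonneg_left h1 (by positivity : 0 ≤ 4 * π)
  refine this.trans (le_of_eq ?_)
  ring

lemma circleSq_sub_le {g : ℂ → ℂ} (hg : DifferentiableOn ℂ g (Metric.ball 0 1))
    (hD : dirichletIntegral g ≠ ⊤) {r s : ℝ} (hr : r ∈ Ico (0 : ℝ) 1) (hs : s ∈ Ico (0 : ℝ) 1) :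
    circleSq g r - circleSq g (r * s) ≤ 2 * π * (1 - s ^ 2) * (dirichletIntegral g).toReal := by
  have h1 : HasSum (fun n : ℕ => (n : ℝ) * ‖taylorCoeff g n‖ ^ 2) (dirichletIntegral g).toReal := by
    rw [dirichletIntegral_eq_tsum hg] at hD ⊢
    have := ENNReal.hasSum_toReal hD
    rw [← ENNReal.tsum_toReal_eq fun n => ENNReal.ofReal_ne_top] at this
    simpa only [ENNReal.toReal_ofReal (mul_nonneg (Nat.cast_nonneg _) (sq_nonneg _))] using this
  have h2 := (hasSum_circleSq hg hr).sub (hasSum_circleSq hg (mul_mem_Ico hr hs))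
  refine hasSum_le (fun n => ?_) h2 (h1.mul_left (2 * π * (1 - s ^ 2)))
  have h3 : r ^ (2 * n) ≤ 1 := pow_le_one₀ hr.1 hr.2.le
  -- Bernoulli's inequality.
  have h4 : 1 - s ^ (2 * n) ≤ n * (1 - s ^ 2) := by
    have := one_add_mul_le_pow (a := s ^ 2 - 1) (by nlinarith [hs.1]) n
    rw [add_sub_cancel, ← pow_mul] at this
    linarith
  have h5 : 0 ≤ 1 - s ^ (2 * n) := sub_nonneg.2 (pow_le_one₀ hs.1 hs.2.le)
  have h6 : r ^ (2 * n) * (1 - s ^ (2 * n)) ≤ n * (1 - s ^ 2) := by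
    nlinarith [pow_nonneg hr.1 (2 * n)]
  calc _ = 2 * π * (‖taylorCoeff g n‖ ^ 2 * (r ^ (2 * n) * (1 - s ^ (2 * n)))) := by
        rw [mul_pow]; ring
    _ ≤ 2 * π * (‖taylorCoeff g n‖ ^ 2 * (n * (1 - s ^ 2))) := by gcongr
    _ = _ := by ring
end

section
variable {u : Circle → ℝ}

/-- The Poisson kernel over 1 − s² is |ξ−sζ|⁻². The quadratic error over 1 − s² is still O(1−s), so
it disappears as s → 1. -/
lemma lintegral_energy_div_le (hu : Integrable u arcLength) (h0 : ∀ᵐ ζ ∂arcLength, u ζ ≤ 0)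
    (hD : dirichletIntegral (outerExp u) ≠ ⊤) {r : ℝ} (hr : r ∈ Ico (0 : ℝ) 1) :
    ∃ C, ∀ s ∈ Ico (0 : ℝ) 1, ∫⁻ p : Circle × Circle, ENNReal.ofReal
      ((Real.exp (2 * poissonDilate u r p.1) - Real.exp (2 * poissonDilate u r p.2)) *
        (poissonDilate u r p.1 - poissonDilate u r p.2) / ‖(p.2 : ℂ) - s * p.1‖ ^ 2)
          ∂(arcLength.prod arcLength) ≤
      ENNReal.ofReal (C * (1 - s) + 4 * π ^ 2 * (dirichletIntegral (outerExp u)).toReal) := by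
  obtain ⟨C, hC⟩ := energy_poissonDilate_le hu h0 hr
  refine ⟨|C|, fun s hs => ?_⟩
  have h1 := hC s hs
  have h2 := circleSq_sub_le (differentiableOn_outerExp hu) hD hr hs
  have h3 : 0 < 1 - s ^ 2 := by nlinarith [hs.1, hs.2]
  have hvc : Continuous (poissonDilate u r) := continuous_poissonDilate hu hr
  have hint : Integrable (fun p : Circle × Circle =>
      (Real.exp (2 * poissonDilate u r p.1) - Real.exp (2 * poissonDilate u r p.2)) *
        (poissonDilate u r p.1 - poissonDilate u r p.2) * diskPoisson (s * p.1) p.2)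
      (arcLength.prod arcLength) :=
    integrable_mul_diskPoisson_prod hs (Continuous.integrable_of_hasCompactSupport (by fun_prop)
      (HasCompactSupport.of_compactSpace _))
  have e : ∀ p : Circle × Circle,
      (Real.exp (2 * poissonDilate u r p.1) - Real.exp (2 * poissonDilate u r p.2)) *
        (poissonDilate u r p.1 - poissonDilate u r p.2) / ‖(p.2 : ℂ) - s * p.1‖ ^ 2 =
      (1 - s ^ 2)⁻¹ * ((Real.exp (2 * poissonDilate u r p.1) -
        Real.exp (2 * poissonDilate u r p.2)) *
        (poissonDilate u r p.1 - poissonDilate u r p.2) * diskPoisson (s * p.1) p.2) := by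
    intro p
    rw [diskPoisson, norm_real_mul_circle hs.1]
    field_simp
  simp only [e]
  rw [← ofReal_integral_eq_lintegral_ofReal (hint.const_mul _), integral_const_mul]
  · apply ENNReal.ofReal_le_ofReal
    rw [inv_mul_le_iff₀ h3]
    refine h1.trans ?_
    have h4 : C * (1 - s) ^ 2 ≤ (1 - s ^ 2) * (|C| * (1 - s)) := by
      have h5 : C * (1 - s) ^ 2 ≤ |C| * (1 - s) ^ 2 := by
        gcongr; exact le_abs_self C
      have h6 : (1 - s) ^ 2 ≤ (1 - s ^ 2) * (1 - s) := by nlinarith [hs.1, hs.2]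
      nlinarith [mul_le_mul_of_nonneg_left h6 (abs_nonneg C)]
    have h7 := mul_le_mul_of_nonneg_left h2 (by positivity : 0 ≤ 2 * π)
    linarith
  · refine ae_of_all _ fun p => mul_nonneg (by positivity) (mul_nonneg
      (exp_sub_exp_mul_sub_nonneg _ _) (diskPoisson_nonneg (norm_real_mul_circle_lt_one hs _) _))

lemma exists_seq_tendsto_one : ∃ s : ℕ → ℝ, (∀ k, s k ∈ Ico (0 : ℝ) 1) ∧
    Tendsto s atTop (𝓝[<] 1) := by
  obtain ⟨s, -, h1, h2⟩ := exists_seq_strictMono_tendsto' (zero_lt_one' ℝ)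
  refine ⟨s, fun k => ⟨(h1 k).1.le, (h1 k).2⟩, tendsto_nhdsWithin_iff.2 ⟨h2, ?_⟩⟩
  exact Eventually.of_forall fun k => (h1 k).2

lemma carlesonEnergy_poissonDilate_le (hu : Integrable u arcLength)
    (h0 : ∀ᵐ ζ ∂arcLength, u ζ ≤ 0) (hD : dirichletIntegral (outerExp u) ≠ ⊤) {r : ℝ}
    (hr : r ∈ Ico (0 : ℝ) 1) :
    carlesonEnergy (poissonDilate u r) ≤
      ENNReal.ofReal (4 * π ^ 2 * (dirichletIntegral (outerExp u)).toReal) := by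
  obtain ⟨C, hC⟩ := lintegral_energy_div_le hu h0 hD hr
  obtain ⟨s, hs, hs1⟩ := exists_seq_tendsto_one
  have hs2 := tendsto_nhds_of_tendsto_nhdsWithin hs1
  have hvc : Continuous (poissonDilate u r) := continuous_poissonDilate hu hr
  refine lintegral_le_of_tendsto_of_le (fun k => ?_) ?_ (fun k => hC (s k) (hs k)) ?_
  · refine ENNReal.measurable_ofReal.comp (Measurable.div ?_ ?_)
    · exact Continuous.measurable (by fun_prop)
    · exact Continuous.measurable (by fun_prop)
  · refine ae_of_all _ fun p => (ENNReal.continuous_ofReal.tendsto _).comp ?_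
    by_cases hp : p.1 = p.2
    · simp [carlesonIntegrand, hp]
    · have hne : (p.2 : ℂ) - p.1 ≠ 0 := sub_ne_zero.2 fun h => hp (Circle.ext h).symm
      rw [carlesonIntegrand, norm_sub_rev]
      have h1 : Tendsto (fun k => ‖(p.2 : ℂ) - (s k : ℂ) * p.1‖ ^ 2) atTop
          (𝓝 (‖(p.2 : ℂ) - ((1 : ℝ) : ℂ) * p.1‖ ^ 2)) := by
        have : Continuous fun x : ℝ => ‖(p.2 : ℂ) - (x : ℂ) * p.1‖ ^ 2 := by fun_prop
        exact (this.tendsto 1).comp hs2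
      rw [Complex.ofReal_one, one_mul] at h1
      exact tendsto_const_nhds.div h1 (by positivity)
  · have : Continuous fun x : ℝ => ENNReal.ofReal
        (C * (1 - x) + 4 * π ^ 2 * (dirichletIntegral (outerExp u)).toReal) :=
      ENNReal.continuous_ofReal.comp (by fun_prop)
    simpa [Function.comp_def] using (this.tendsto 1).comp hs2

/-- The lower bound in Carleson's formula. -/
theorem carlesonEnergy_le_dirichletIntegral_outerExp (hu : Integrable u arcLength)
    (h0 : ∀ᵐ ζ ∂arcLength, u ζ ≤ 0) :
    ENNReal.ofReal (1 / (4 * π ^ 2)) * carlesonEnergy u ≤ dirichletIntegral (outerExp u) := by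
  by_cases hD : dirichletIntegral (outerExp u) = ⊤
  · rw [hD]; exact le_top
  obtain ⟨r, hr, hr1⟩ := exists_seq_tendsto_one
  have hae : ∀ᵐ ζ ∂arcLength, Tendsto (fun k => poissonDilate u (r k) ζ) atTop (𝓝 (u ζ)) := by
    filter_upwards [ae_tendsto_poissonIntegral hu] with ζ hζ using hζ.comp hr1
  have h1 : carlesonEnergy u ≤
      ENNReal.ofReal (4 * π ^ 2 * (dirichletIntegral (outerExp u)).toReal) := by
    refine lintegral_le_of_tendsto_of_le (fun k => (measurable_carlesonIntegrand
      (continuous_poissonDilate hu (hr k)).measurable).ennreal_ofReal) ?_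
      (fun k => carlesonEnergy_poissonDilate_le hu h0 hD (hr k)) tendsto_const_nhds
    filter_upwards [Measure.quasiMeasurePreserving_fst.ae hae,
      Measure.quasiMeasurePreserving_snd.ae hae] with p hp1 hp2
    refine (ENNReal.continuous_ofReal.tendsto _).comp ?_
    have h2 : ∀ {x : Circle}, Tendsto (fun k => poissonDilate u (r k) x) atTop (𝓝 (u x)) →
        Tendsto (fun k => Real.exp (2 * poissonDilate u (r k) x)) atTop
          (𝓝 (Real.exp (2 * u x))) := fun h =>
      (Real.continuous_exp.tendsto _).comp (h.const_mul 2)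
    exact (((h2 hp1).sub (h2 hp2)).mul (hp1.sub hp2)).div_const _
  calc ENNReal.ofReal (1 / (4 * π ^ 2)) * carlesonEnergy u
      ≤ ENNReal.ofReal (1 / (4 * π ^ 2)) *
        ENNReal.ofReal (4 * π ^ 2 * (dirichletIntegral (outerExp u)).toReal) := by gcongr
    _ = dirichletIntegral (outerExp u) := by
        rw [← ENNReal.ofReal_mul (by positivity), ← mul_assoc, one_div_mul_cancel (by positivity),
          one_mul, ENNReal.ofReal_toReal hD]
end

/-! ### Arcs, chords and the distance to E. -/

lemma arcDist_le_mul_norm_sub (ζ ξ : Circle) : arcDist ζ ξ ≤ π / 2 * ‖(ζ : ℂ) - ξ‖ := by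
  have h := Complex.angle_le_mul_norm_sub (Circle.norm_coe ζ) (Circle.norm_coe ξ)
  rwa [Complex.angle_eq_abs_arg (by simp) (by simp)] at h

lemma arcInfDist_le_arcDist {E : Set Circle} (ζ : Circle) {ξ : Circle} (hξ : ξ ∈ E) :
    arcInfDist ζ E ≤ arcDist ζ ξ :=
  csInf_le ⟨0, by rintro _ ⟨x, -, rfl⟩; exact abs_nonneg _⟩ ⟨ξ, hξ, rfl⟩

lemma arcInfDist_le_pi {E : Set Circle} (hE : E.Nonempty) (ζ : Circle) : arcInfDist ζ E ≤ π :=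
  (arcInfDist_le_arcDist ζ hE.some_mem).trans (Complex.abs_arg_le_pi _)

/-- Absolute values absorb the jump of the argument at x = −π. -/
lemma abs_arg_exp_le {x : ℝ} (hx : |x| ≤ π) : |Complex.arg (Circle.exp x : ℂ)| ≤ |x| := by
  rcases eq_or_lt_of_le (abs_le.1 hx).1 with h | h
  · rw [← h, abs_neg, abs_of_pos Real.pi_pos]
    exact Complex.abs_arg_le_pi _
  · rw [Circle.arg_exp h (abs_le.1 hx).2]

lemma arcDist_eq_abs_arg_div (ζ ξ : Circle) :
    arcDist ζ ξ = |Complex.arg ((ζ / ξ : Circle) : ℂ)| := by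
  rw [arcDist, Circle.coe_div]

/-- Points in different members of a disjoint open family are separated by a point of the
complement lying on the shorter arc between them. -/
lemma exists_mem_arcDist_le {ι : Type*} {U : ι → Set Circle} {E : Set Circle}
    (hU : ∀ j, IsOpen (U j)) (hd : Pairwise fun j k => Disjoint (U j) (U k))
    (hE : (⋃ j, U j) = Eᶜ) {j k : ι} (hjk : j ≠ k) {ζ ξ : Circle} (hζ : ζ ∈ U j) (hξ : ξ ∈ U k) :
    ∃ η ∈ E, arcDist ζ η ≤ arcDist ζ ξ ∧ arcDist ξ η ≤ arcDist ζ ξ := by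
  set α : ℝ := Complex.arg ((ζ / ξ : Circle) : ℂ) with hα
  -- The shorter arc from ξ to ζ. If it missed E, the open sets U j and the union of the others
  -- would disconnect it.
  let γ : ℝ → Circle := fun t => ξ * Circle.exp (t * α)
  have hγ : Continuous γ := by fun_prop
  have hγ0 : γ 0 = ξ := by simp [γ]
  have hexp : Circle.exp α = ζ / ξ := Circle.exp_arg _
  have hγ1 : γ 1 = ζ := by simp only [γ, one_mul, hexp, mul_div_cancel]
  have hpre : IsPreconnected (γ '' Icc 0 1) := isPreconnected_Icc.image _ hγ.continuousOn
  have hex : ∃ t ∈ Icc (0 : ℝ) 1, γ t ∈ E := by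
    by_contra! hcon
    have hsub : γ '' Icc 0 1 ⊆ U j ∪ ⋃ i ∈ {i | i ≠ j}, U i := by
      rintro _ ⟨t, ht, rfl⟩
      have : γ t ∈ ⋃ i, U i := by rw [hE]; exact hcon t ht
      obtain ⟨i, hi⟩ := mem_iUnion.1 this
      by_cases hij : i = j
      · exact Or.inl (hij ▸ hi)
      · exact Or.inr (mem_biUnion (show i ∈ {i | i ≠ j} from hij) hi)
    obtain ⟨x, -, hx1, hx2⟩ := hpre _ _ (hU j) (isOpen_biUnion fun i _ => hU i) hsub
      ⟨ζ, ⟨1, by simp, hγ1⟩, hζ⟩ ⟨ξ, ⟨0, by simp, hγ0⟩,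
        mem_biUnion (show k ∈ {i | i ≠ j} from hjk.symm) hξ⟩
    obtain ⟨i, hi, hx3⟩ := mem_iUnion₂.1 hx2
    exact (hd (show j ≠ i from fun h => hi h.symm)).le_bot ⟨hx1, hx3⟩
  obtain ⟨t, ht, htE⟩ := hex
  have hαpi := Complex.abs_arg_le_pi ((ζ / ξ : Circle) : ℂ)
  rw [← hα] at hαpi
  have hζ' : ζ = ξ * Circle.exp α := by rw [hexp, mul_div_cancel]
  have key : ∀ x : ℝ, |x| ≤ 1 → |Complex.arg (Circle.exp (x * α) : ℂ)| ≤ |α| := fun x hx => by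
    have h1 : |x * α| ≤ |α| := by
      rw [abs_mul]; exact mul_le_of_le_one_left (abs_nonneg _) hx
    exact (abs_arg_exp_le (h1.trans hαpi)).trans h1
  refine ⟨γ t, htE, ?_, ?_⟩ <;> rw [arcDist_eq_abs_arg_div, arcDist_eq_abs_arg_div ζ ξ, ← hα]
  · have h1 : ζ / γ t = Circle.exp ((1 - t) * α) := by
      rw [sub_mul, one_mul, Circle.exp_sub, hζ', mul_div_mul_left_eq_div]
    rw [h1]
    exact key _ (by rw [abs_le]; constructor <;> linarith [ht.1, ht.2])
  · have h1 : ξ / γ t = Circle.exp (-t * α) := by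
      rw [neg_mul, Circle.exp_neg, div_mul_cancel_left]
    rw [h1]
    exact key _ (by rw [abs_le]; constructor <;> linarith [ht.1, ht.2])

/-! ### Pointwise comparison of the integrands and gluing. -/

lemma dirichletIntegral_congr {f g : ℂ → ℂ} (h : ∀ z, ‖z‖ < 1 → f z = g z) :
    dirichletIntegral f = dirichletIntegral g := by
  rw [dirichletIntegral, dirichletIntegral]
  congr 1
  refine setLIntegral_congr_fun Metric.isOpen_ball.measurableSet fun z hz => ?_
  have h1 : f =ᶠ[𝓝 z] g := by
    filter_upwards [Metric.isOpen_ball.mem_nhds hz] with w hw using h w (by simpa using hw)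
  simp only [h1.deriv_eq]

lemma log_one_div_norm_outerExp_zero {u : Circle → ℝ} (hu : Integrable u arcLength) :
    2 * π * Real.log (1 / ‖outerExp u 0‖) = ∫ ζ, -u ζ ∂arcLength := by
  have h1 : ∀ ζ, diskPoisson 0 ζ = 1 := fun ζ => by simp [diskPoisson, Circle.norm_coe]
  rw [norm_outerExp hu (by simp), one_div, ← Real.exp_neg, Real.log_exp, poissonIntegral,
    integral_neg]
  simp only [h1, smul_eq_mul]
  field_simp

/-- If b ≤ a, the numerator is at most e^{2a}(a−b), with e^{2a} ≤ D²/4 and a − b ≤ −b ≤ −a − b. -/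
lemma carleson_quotient_le {a b D : ℝ} (hD : 0 < D) (ha0 : a ≤ 0) (hb0 : b ≤ 0)
    (ha : Real.exp a ≤ D / 2) (hb : Real.exp b ≤ D / 2) :
    (Real.exp (2 * a) - Real.exp (2 * b)) * (a - b) / D ^ 2 ≤ 1 / 4 * (-a + -b) := by
  wlog h : b ≤ a generalizing a b
  · have := this hb0 ha0 hb ha (le_of_not_ge h)
    rw [add_comm (-b)] at this
    refine le_trans (le_of_eq ?_) this
    ring
  rw [div_le_iff₀ (by positivity)]
  have h1 : Real.exp (2 * a) ≤ D ^ 2 / 4 := by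
    have : Real.exp (2 * a) = Real.exp a ^ 2 := by rw [← Real.exp_nat_mul]; rfl
    rw [this]
    nlinarith [Real.exp_pos a]
  calc (Real.exp (2 * a) - Real.exp (2 * b)) * (a - b) ≤ Real.exp (2 * a) * (a - b) := by
        have := Real.exp_pos (2 * b)
        exact mul_le_mul_of_nonneg_right (by linarith) (by linarith)
    _ ≤ D ^ 2 / 4 * (-a + -b) := by
        refine mul_le_mul h1 (by linarith) (by linarith) (by positivity)
    _ = _ := by ring

section
variable {ι : Type*} [Fintype ι] {E : Set Circle} {U : ι → Set Circle} {u : Circle → ℝ}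
  {v : ι → Circle → ℝ}

/-- Points in one piece use the first sum, points in different pieces the second; all other summands
are nonnegative and can be added freely. -/
lemma carlesonIntegrand_le_sum (hU : ∀ j, IsOpen (U j))
    (hd : Pairwise fun j k => Disjoint (U j) (U k)) (hE : (⋃ j, U j) = Eᶜ) {p : Circle × Circle}
    (hE1 : p.1 ∉ E) (hE2 : p.2 ∉ E)
    (hu1 : ∀ j, p.1 ∈ U j → u p.1 = v j p.1) (hu2 : ∀ j, p.2 ∈ U j → u p.2 = v j p.2)
    (h1 : ∀ j, v j p.1 ≤ 0) (h2 : ∀ j, v j p.2 ≤ 0)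
    (hb1 : ∀ j, Real.exp (v j p.1) ≤ π⁻¹ * arcInfDist p.1 E)
    (hb2 : ∀ j, Real.exp (v j p.2) ≤ π⁻¹ * arcInfDist p.2 E) :
    carlesonIntegrand u p ≤
      ∑ j, carlesonIntegrand (v j) p + ∑ j, 1 / 4 * (-v j p.1 + -v j p.2) := by
  have hn : ∀ j, 0 ≤ 1 / 4 * (-v j p.1 + -v j p.2) := fun j => by linarith [h1 j, h2 j]
  obtain ⟨j, hj⟩ := mem_iUnion.1 (show p.1 ∈ ⋃ j, U j by rw [hE]; exact hE1)
  obtain ⟨k, hk⟩ := mem_iUnion.1 (show p.2 ∈ ⋃ j, U j by rw [hE]; exact hE2)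
  by_cases hjk : j = k
  · subst hjk
    have e : carlesonIntegrand u p = carlesonIntegrand (v j) p := by
      rw [carlesonIntegrand, hu1 j hj, hu2 j hk, carlesonIntegrand]
    have h3 := Finset.single_le_sum (f := fun j => carlesonIntegrand (v j) p)
      (fun i _ => carlesonIntegrand_nonneg (v i) p) (Finset.mem_univ j)
    have h4 := Finset.sum_nonneg (s := Finset.univ) fun i _ => hn i
    rw [e]
    linarith
  · obtain ⟨η, hη, hη1, hη2⟩ := exists_mem_arcDist_le hU hd hE hjk hj hk
    have hchord := arcDist_le_mul_norm_sub p.1 p.2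
    have hhalf : π⁻¹ * (π / 2 * ‖(p.1 : ℂ) - p.2‖) = ‖(p.1 : ℂ) - p.2‖ / 2 := by field_simp
    have b1 : Real.exp (v j p.1) ≤ ‖(p.1 : ℂ) - p.2‖ / 2 := by
      rw [← hhalf]
      exact (hb1 j).trans (mul_le_mul_of_nonneg_left
        (((arcInfDist_le_arcDist _ hη).trans hη1).trans hchord) (by positivity))
    have b2 : Real.exp (v k p.2) ≤ ‖(p.1 : ℂ) - p.2‖ / 2 := by
      rw [← hhalf]
      exact (hb2 k).trans (mul_le_mul_of_nonneg_left
        (((arcInfDist_le_arcDist _ hη).trans hη2).trans hchord) (by positivity))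
    -- The chord is positive because it dominates an exponential.
    have hD : 0 < ‖(p.1 : ℂ) - p.2‖ := by linarith [Real.exp_pos (v j p.1)]
    have h3 := carleson_quotient_le hD (h1 j) (h2 k) b1 b2
    have h4 := Finset.sum_nonneg (s := Finset.univ) fun i _ => carlesonIntegrand_nonneg (v i) p
    have h5 := Finset.single_le_sum (f := fun j => -v j p.1)
      (fun i _ => neg_nonneg.2 (h1 i)) (Finset.mem_univ j)
    have h6 := Finset.single_le_sum (f := fun j => -v j p.2)
      (fun i _ => neg_nonneg.2 (h2 i)) (Finset.mem_univ k)
    rw [← Finset.mul_sum, Finset.sum_add_distrib, carlesonIntegrand, hu1 j hj, hu2 k hk]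
    linarith

lemma integral_prod_fst_add_snd {w : Circle → ℝ} (hw : Integrable w arcLength) :
    ∫ p : Circle × Circle, (w p.1 + w p.2) ∂(arcLength.prod arcLength) =
      4 * π * ∫ ζ, w ζ ∂arcLength := by
  rw [integral_add (hw.comp_fst arcLength) (hw.comp_snd arcLength), integral_fun_fst,
    integral_fun_snd, Measure.real, arcLength_univ, ENNReal.toReal_ofReal (by positivity),
    smul_eq_mul]
  ring

lemma carlesonEnergy_le_sum (hEnull : arcLength E = 0) (hU : ∀ j, IsOpen (U j))
    (hd : Pairwise fun j k => Disjoint (U j) (U k)) (hE : (⋃ j, U j) = Eᶜ)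
    (huv : ∀ j, ∀ᵐ ζ ∂arcLength, ζ ∈ U j → u ζ = v j ζ) (hv : ∀ j, Integrable (v j) arcLength)
    (hvm : ∀ j, Measurable (v j)) (hv0 : ∀ j, ∀ᵐ ζ ∂arcLength, v j ζ ≤ 0)
    (hb : ∀ j, ∀ᵐ ζ ∂arcLength, Real.exp (v j ζ) ≤ π⁻¹ * arcInfDist ζ E) :
    carlesonEnergy u ≤ ∑ j, carlesonEnergy (v j) +
      ENNReal.ofReal (∑ j, π * ∫ ζ, -v j ζ ∂arcLength) := by
  have hae : ∀ᵐ ζ ∂arcLength, ζ ∉ E ∧ (∀ j, ζ ∈ U j → u ζ = v j ζ) ∧ (∀ j, v j ζ ≤ 0) ∧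
      ∀ j, Real.exp (v j ζ) ≤ π⁻¹ * arcInfDist ζ E := by
    filter_upwards [measure_eq_zero_iff_ae_notMem.1 hEnull, ae_all_iff.2 huv, ae_all_iff.2 hv0,
      ae_all_iff.2 hb] with ζ h1 h2 h3 h4 using ⟨h1, h2, h3, h4⟩
  have h1 := Measure.quasiMeasurePreserving_fst (μ := arcLength) (ν := arcLength) |>.ae hae
  have h2 := Measure.quasiMeasurePreserving_snd (μ := arcLength) (ν := arcLength) |>.ae hae
  have hj : ∀ j, Integrable (fun p : Circle × Circle => 1 / 4 * (-v j p.1 + -v j p.2))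
      (arcLength.prod arcLength) := fun j =>
    (((hv j).neg.comp_fst arcLength).add ((hv j).neg.comp_snd arcLength)).const_mul _
  have hint := integrable_finsetSum Finset.univ fun j _ => hj j
  have hval : ∫ p : Circle × Circle, ∑ j, 1 / 4 * (-v j p.1 + -v j p.2)
      ∂(arcLength.prod arcLength) = ∑ j, π * ∫ ζ, -v j ζ ∂arcLength := by
    rw [integral_finsetSum _ fun j _ => hj j]
    refine Finset.sum_congr rfl fun j _ => ?_
    rw [integral_const_mul, integral_prod_fst_add_snd (w := fun ζ => -v j ζ) (hv j).neg]
    ring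
  calc carlesonEnergy u
      ≤ ∫⁻ p, (∑ j, ENNReal.ofReal (carlesonIntegrand (v j) p) +
          ENNReal.ofReal (∑ j, 1 / 4 * (-v j p.1 + -v j p.2))) ∂(arcLength.prod arcLength) := by
        refine lintegral_mono_ae ?_
        filter_upwards [h1, h2] with p hp1 hp2
        rw [← ENNReal.ofReal_sum_of_nonneg fun j _ => carlesonIntegrand_nonneg (v j) p]
        refine le_trans (ENNReal.ofReal_le_ofReal ?_) ENNReal.ofReal_add_le
        exact carlesonIntegrand_le_sum hU hd hE hp1.1 hp2.1 hp1.2.1 hp2.2.1 hp1.2.2.1 hp2.2.2.1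
          hp1.2.2.2 hp2.2.2.2
    _ = _ := by
        have hm : ∀ j, Measurable fun p => ENNReal.ofReal (carlesonIntegrand (v j) p) := fun j =>
          (measurable_carlesonIntegrand (hvm j)).ennreal_ofReal
        rw [lintegral_add_left (Finset.measurable_fun_sum _ fun j _ => hm j),
          lintegral_finsetSum _ fun j _ => hm j, ← hval, ofReal_integral_eq_lintegral_ofReal hint]
        · rfl
        · filter_upwards [h1, h2] with p hp1 hp2
          exact Finset.sum_nonneg fun j _ => by linarith [hp1.2.2.1 j, hp2.2.2.1 j]
end

/-- Gluing integrable functions along a finite disjoint family of open sets. -/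
lemma exists_integrable_eq_on {ι : Type*} [Fintype ι] {U : ι → Set Circle} {v : ι → Circle → ℝ}
    (hU : ∀ j, IsOpen (U j)) (hd : Pairwise fun j k => Disjoint (U j) (U k))
    (hv : ∀ j, Integrable (v j) arcLength) :
    ∃ u : Circle → ℝ, Integrable u arcLength ∧ ∀ j, ∀ ζ ∈ U j, u ζ = v j ζ := by
  refine ⟨fun ζ => ∑ j, (U j).indicator (v j) ζ,
    integrable_finsetSum _ fun j _ => (hv j).indicator (hU j).measurableSet, fun j ζ hζ => ?_⟩
  dsimp only
  rw [Finset.sum_eq_single j, indicator_of_mem hζ]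
  · exact fun k _ hk => indicator_of_notMem (fun h => (hd hk).le_bot ⟨h, hζ⟩) _
  · exact fun h => absurd (Finset.mem_univ j) h

theorem lemmaL (n : ℕ) (E : Set Circle) (hE_closed : IsClosed E) (hE_nonempty : E.Nonempty)
    (hE_null : arcLength E = 0)
    (h_ : Fin n → ℂ → ℂ)
    (h_mem : ∀ j, InDirichletSpace (h_ j))
    (h_outer : ∀ j, IsOuter (h_ j))
    (h_bound : ∀ j, ∀ᵐ ζ ∂arcLength,
      ‖radialLimit (h_ j) ζ‖ ≤ Real.pi⁻¹ * arcInfDist ζ E)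
    (U : Fin n → Set Circle)
    (hU_open : ∀ j, IsOpen (U j))
    (hU_disjoint : Pairwise fun j k => Disjoint (U j) (U k))
    (hU_union : (⋃ j, U j) = Eᶜ) :
    (∃ h : ℂ → ℂ, IsOuter h ∧
      ∀ j, ∀ᵐ ζ ∂arcLength, ζ ∈ U j → ‖radialLimit h ζ‖ = ‖radialLimit (h_ j) ζ‖) ∧
    ∀ h : ℂ → ℂ, IsOuter h →
      (∀ j, ∀ᵐ ζ ∂arcLength, ζ ∈ U j → ‖radialLimit h ζ‖ = ‖radialLimit (h_ j) ζ‖) →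
      InDirichletSpace h ∧
      (dirichletIntegral h).toReal ≤
        ∑ j, (dirichletIntegral (h_ j)).toReal +
          1 / 2 * ∑ j, Real.log (1 / ‖h_ j 0‖) := by
  choose v hvm hv hveq using fun j => (h_outer j).exists_outerExp
  have hlim : ∀ j, ∀ᵐ ζ ∂arcLength, ‖radialLimit (h_ j) ζ‖ = Real.exp (v j ζ) := fun j =>
    ae_norm_radialLimit_outerExp (hv j) (hveq j)
  have hb : ∀ j, ∀ᵐ ζ ∂arcLength, Real.exp (v j ζ) ≤ π⁻¹ * arcInfDist ζ E := fun j => by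
    filter_upwards [hlim j, h_bound j] with ζ h1 h2
    rwa [h1] at h2
  -- Since d(ζ, E) ≤ π, the normalisation π⁻¹ makes every boundary modulus at most 1.
  have hv0 : ∀ j, ∀ᵐ ζ ∂arcLength, v j ζ ≤ 0 := fun j => by
    filter_upwards [hb j] with ζ h1
    rw [← Real.exp_le_one_iff]
    refine h1.trans ?_
    rw [inv_mul_le_one₀ Real.pi_pos]
    exact arcInfDist_le_pi hE_nonempty ζ
  refine ⟨?_, fun h hh hhU => ?_⟩
  · obtain ⟨u, hu, huv⟩ := exists_integrable_eq_on hU_open hU_disjoint hv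
    refine ⟨outerExp u, isOuter_outerExp hu, fun j => ?_⟩
    filter_upwards [ae_norm_radialLimit_outerExp hu fun _ _ => rfl, hlim j] with ζ h1 h2 hζ
    rw [h1, h2, huv j ζ hζ]
  obtain ⟨u, hum, hu, hueq⟩ := hh.exists_outerExp
  have huv : ∀ j, ∀ᵐ ζ ∂arcLength, ζ ∈ U j → u ζ = v j ζ := fun j => by
    filter_upwards [ae_norm_radialLimit_outerExp hu hueq, hlim j, hhU j] with ζ h1 h2 h3 hζ
    have := h3 hζ
    rwa [h1, h2, Real.exp_eq_exp] at this
  have hu0 : ∀ᵐ ζ ∂arcLength, u ζ ≤ 0 := by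
    filter_upwards [measure_eq_zero_iff_ae_notMem.1 hE_null, ae_all_iff.2 huv, ae_all_iff.2 hv0]
      with ζ h1 h2 h3
    obtain ⟨j, hj⟩ := mem_iUnion.1 (show ζ ∈ ⋃ j, U j by rw [hU_union]; exact h1)
    rw [h2 j hj]
    exact h3 j
  have hL : ∀ j, 0 ≤ ∫ ζ, -v j ζ ∂arcLength := fun j => by
    refine integral_nonneg_of_ae ?_
    filter_upwards [hv0 j] with ζ hζ
    simpa using hζ
  have hlog : ∀ j, Real.log (1 / ‖h_ j 0‖) = (2 * π)⁻¹ * ∫ ζ, -v j ζ ∂arcLength := fun j => by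
    rw [← log_one_div_norm_outerExp_zero (hv j), inv_mul_cancel_left₀ (by positivity),
      hveq j 0 (by simp)]
  have hlog0 : ∀ j, 0 ≤ Real.log (1 / ‖h_ j 0‖) := fun j => by
    rw [hlog j]; exact mul_nonneg (by positivity) (hL j)
  have hmain : dirichletIntegral h ≤ ∑ j, dirichletIntegral (h_ j) +
      ENNReal.ofReal (1 / 2 * ∑ j, Real.log (1 / ‖h_ j 0‖)) := by
    rw [dirichletIntegral_congr hueq]
    calc dirichletIntegral (outerExp u)
        ≤ ENNReal.ofReal (1 / (4 * π ^ 2)) * carlesonEnergy u :=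
          dirichletIntegral_outerExp_le hum hu hu0
      _ ≤ ENNReal.ofReal (1 / (4 * π ^ 2)) * (∑ j, carlesonEnergy (v j) +
          ENNReal.ofReal (∑ j, π * ∫ ζ, -v j ζ ∂arcLength)) := by
          gcongr
          exact carlesonEnergy_le_sum hE_null hU_open hU_disjoint hU_union huv hv hvm hv0 hb
      _ = ∑ j, ENNReal.ofReal (1 / (4 * π ^ 2)) * carlesonEnergy (v j) +
          ENNReal.ofReal (1 / 2 * ∑ j, Real.log (1 / ‖h_ j 0‖)) := by
          -- Since ∫ −v_j = 2π log 1/|h_j(0)|, the constant is (4π²)⁻¹ · π · 2π = ½.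
          rw [mul_add, Finset.mul_sum, ← ENNReal.ofReal_mul (by positivity), Finset.mul_sum,
            Finset.mul_sum]
          congr 2
          refine Finset.sum_congr rfl fun j _ => ?_
          rw [hlog j]
          field_simp
          ring
      _ ≤ _ := by
          gcongr with j
          rw [dirichletIntegral_congr (hveq j)]
          exact carlesonEnergy_le_dirichletIntegral_outerExp (hv j) (hv0 j)
  have hsum : ∑ j, dirichletIntegral (h_ j) ≠ ⊤ :=
    ENNReal.sum_ne_top.2 fun j _ => (h_mem j).2.ne
  refine ⟨⟨?_, hmain.trans_lt (ENNReal.add_lt_top.2 ⟨hsum.lt_top, ENNReal.ofReal_lt_top⟩)⟩, ?_⟩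
  · exact (differentiableOn_outerExp hu).congr fun z hz => hueq z (by simpa using hz)
  · have h1 := ENNReal.toReal_mono (ENNReal.add_ne_top.2 ⟨hsum, ENNReal.ofReal_ne_top⟩) hmain
    rwa [ENNReal.toReal_add hsum ENNReal.ofReal_ne_top,
      ENNReal.toReal_sum fun j _ => (h_mem j).2.ne, ENNReal.toReal_ofReal
      (mul_nonneg (by norm_num) (Finset.sum_nonneg fun j _ => hlog0 j))] at h1
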